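/- **Setting.** Let $\phi\colon[0,\infty)\to[0,\infty]$ be convex with $\phi(1)=0$, and let $d(p,q)=\sum_{i} q_i\,\phi(p_i/q_i)$ be the associated $\phi$-divergence (with the usual conventions $0\,\phi(0/0)=0$ and $0\,\phi(x/0)=x\lim_{t\to\infty}\phi(t)/t$). Write $\Delta_n$ for the probability simplex in $\mathbb R^n$. *Projection problem.* For $\overline p\in\Delta_S$, $b\in\mathbb R^S_+$, $\beta\in\mathbb R_+$ let $$\mathfrak P(\overline p;b,\beta)=\inf\{d(p,\overline p): p\in\Delta_S,\ b^\top p\le\beta\}.$$ The data are *admissible* if $\min_i b_i\le\beta<b^\top\overline p$. A pair $(\underline d,\overline d)\in\mathbb R^2$ solves the problem to accuracy $\delta$ if $\mathfrak P(\overline p;b,\beta)\in[\underline d,\overline d]$ and $\overline d-\underline d\le\delta$. *Robust Bellman update.* A robust Markov decision process has $S\ge1$ states, $A\ge1$ actions, nominal transition probabilities $\overline p_{sa}\in\Delta_S$, rewards $r_{sas'}\ge0$, a discount factor $\lambda\in(0,1)$, a budget $\kappa>0$, and the $s$-rectangular ambiguity sets $\mathcal P_s=\{p_s\in(\Delta_S)^A:\sum_a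 d(p_{sa},\overline p_{sa})\le\kappa\}$. For $v\in\mathbb R^S$, $$[\mathfrak J(v)]_s=\max_{\pi\in\Delta_A}\ \inf_{p_s\in\mathcal P_s}\ \sum_a\pi_a\,p_{sa}^\top(r_{sa}+\lambda v),\qquad \overline R=(1-\lambda)^{-1}\max_{s,a,s'}r_{sas'}.$$ A vector $v'$ solves the update to accuracy $\epsilon$ if $\|v'-\mathfrak J(v)\|_\infty\le\epsilon$. *Computation model.* Programs run on a real random access machine: exact real arithmetic, comparisons, indirect addressing, and any fixed family of unary primitive functions $\mathbb R\to\mathbb R$ (such as $\exp$, $\log$), all at unit cost. Memory cells that do not hold the input are arbitrary at the start. **Theorem.** Let $P$ be a program. There is a program $Q$ such that for every $C>0$ there is $C'>0$ with the following property. Let $\mathcal D$ be any class of projection data $(\overline p,b,\beta)$ and $h\colon\mathbb R\to\mathbb R$ any function such that $P$ solves every admissible projection problem in $\mathcal D$ to any accuracy $\delta>0$ in at most $C\,h(\delta)$ steps. Consider any robust Markov decision process as above, any $v$ with $r_{sas'}+\lambda v_{s'}\ge0$ and $v_s\le\overline R$ for all $s,a,s'$, and any $\epsilon>0$. Put $$\delta^\ast=\frac{\epsilon\kappa}{2A\overline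 R+A\epsilon}.$$ Suppose that $(\overline p_{sa},\,r_{sa}+\lambda v,\,\beta)\in\mathcal D$ for all $s$, $a$ and all $\beta$ with $\min_{s'}(r_{sas'}+\lambda v_{s'})+\epsilon/2\le\beta<(r_{sa}+\lambda v)^\top\overline p_{sa}$, and that $h(\delta^\ast)\ge S$ (the time bound accounts for reading the input). Then $Q$ solves the update $\mathfrak J(v)$ to accuracy $\epsilon$ in at most $$C'\cdot A\,S\cdot h(\delta^\ast)\cdot\max\{1,\log(\overline R/\epsilon)\}$$ steps. That is, if the projection problem can be solved to any accuracy $\delta$ in time $\mathcal O(h(\delta))$, then the robust Bellman update can be computed to any accuracy $\epsilon$ in time $\mathcal O\big(AS\cdot h(\epsilon\kappa/[2A\overline R+A\epsilon])\cdot\log(\overline R/\epsilon)\big)$. -/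

import Mathlib

open scoped NNReal ENNReal

noncomputable section

/-! ## Random access machines over the reals

Programs of a small structured language act on a store that consists of arrays of natural
numbers (indices, counters) and arrays of real numbers. Arrays are named statically by natural
numbers; their entries are addressed by computed natural numbers. Every arithmetic operation,
memory access, comparison and assignment counts as one step. -/

namespace RealRAM

/-- Memory contents: `σ.nat k i` and `σ.real k i` are the entries number `i` of the `k`-th array
of natural numbers and of the `k`-th array of real numbers. -/
structure Store where
  nat : ℕ → ℕ → ℕ
  real : ℕ → ℕ → ℝ

/-- Overwrite one entry of an array of natural numbers. -/
def Store.setNat (σ : Store) (k i x : ℕ) : Store :=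
  { σ with nat := Function.update σ.nat k (Function.update (σ.nat k) i x) }

/-- Overwrite one entry of an array of real numbers. -/
def Store.setReal (σ : Store) (k i : ℕ) (x : ℝ) : Store :=
  { σ with real := Function.update σ.real k (Function.update (σ.real k) i x) }

/-- Expressions for natural numbers: literals, array entries, sum and truncated difference. -/
inductive NExp where
  | lit (n : ℕ)
  | get (k : ℕ) (i : NExp)
  | add (e f : NExp)
  | sub (e f : NExp)

def NExp.eval (σ : Store) : NExp → ℕ
  | .lit n => n
  | .get k i => σ.nat k (i.eval σ)
  | .add e f => e.eval σ + f.eval σ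
  | .sub e f => e.eval σ - f.eval σ

/-- Number of elementary operations needed to evaluate the expression. -/
def NExp.cost : NExp → ℕ
  | .lit _ => 1
  | .get _ i => i.cost + 1
  | .add e f => e.cost + f.cost + 1
  | .sub e f => e.cost + f.cost + 1

/-- Expressions for real numbers: rational literals, conversion of natural numbers, array entries,
the four arithmetic operations, and the application of the `j`-th primitive function. -/
inductive RExp where
  | lit (q : ℚ)
  | cast (e : NExp)
  | get (k : ℕ) (i : NExp)
  | add (e f : RExp)
  | sub (e f : RExp)
  | mul (e f : RExp)
  | div (e f : RExp)
  | prim (j : ℕ) (e : RExp)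

/-- `F j` is the `j`-th primitive function of the machine (for example `Real.exp`, `Real.log`,
or a constant). -/
def RExp.eval (F : ℕ → ℝ → ℝ) (σ : Store) : RExp → ℝ
  | .lit q => (q : ℝ)
  | .cast e => (e.eval σ : ℝ)
  | .get k i => σ.real k (i.eval σ)
  | .add e f => e.eval F σ + f.eval F σ
  | .sub e f => e.eval F σ - f.eval F σ
  | .mul e f => e.eval F σ * f.eval F σ
  | .div e f => e.eval F σ / f.eval F σ
  | .prim j e => F j (e.eval F σ)

/-- Number of elementary operations needed to evaluate the expression. -/
def RExp.cost : RExp → ℕ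
  | .lit _ => 1
  | .cast e => e.cost + 1
  | .get _ i => i.cost + 1
  | .add e f => e.cost + f.cost + 1
  | .sub e f => e.cost + f.cost + 1
  | .mul e f => e.cost + f.cost + 1
  | .div e f => e.cost + f.cost + 1
  | .prim _ e => e.cost + 1

/-- Comparisons and their negations. -/
inductive Cond where
  | ltNat (e f : NExp)
  | ltReal (e f : RExp)
  | neg (t : Cond)

def Cond.Holds (F : ℕ → ℝ → ℝ) (σ : Store) : Cond → Prop
  | .ltNat e f => e.eval σ < f.eval σ
  | .ltReal e f => e.eval F σ < f.eval F σ
  | .neg t => ¬ t.Holds F σ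

def Cond.cost : Cond → ℕ
  | .ltNat e f => e.cost + f.cost + 1
  | .ltReal e f => e.cost + f.cost + 1
  | .neg t => t.cost + 1

/-- Programs. -/
inductive Program where
  | skip
  | setNat (k : ℕ) (i e : NExp)
  | setReal (k : ℕ) (i : NExp) (e : RExp)
  | seq (c d : Program)
  | branch (t : Cond) (c d : Program)
  | loop (t : Cond) (c : Program)

/-- `Exec F c σ τ n`: started in the store `σ`, the program `c` halts in the store `τ` after
exactly `n` steps. -/
inductive Exec (F : ℕ → ℝ → ℝ) : Program → Store → Store → ℕ → Prop where
  | skip (σ : Store) : Exec F .skip σ σ 1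
  | setNat (k : ℕ) (i e : NExp) (σ : Store) :
      Exec F (.setNat k i e) σ (σ.setNat k (i.eval σ) (e.eval σ)) (i.cost + e.cost + 1)
  | setReal (k : ℕ) (i : NExp) (e : RExp) (σ : Store) :
      Exec F (.setReal k i e) σ (σ.setReal k (i.eval σ) (e.eval F σ)) (i.cost + e.cost + 1)
  | seq (c d : Program) (σ τ ρ : Store) (m n : ℕ) (hc : Exec F c σ τ m) (hd : Exec F d τ ρ n) :
      Exec F (.seq c d) σ ρ (m + n)
  | branch_pos (t : Cond) (c d : Program) (σ τ : Store) (n : ℕ) (ht : t.Holds F σ)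
      (hc : Exec F c σ τ n) : Exec F (.branch t c d) σ τ (t.cost + n)
  | branch_neg (t : Cond) (c d : Program) (σ τ : Store) (n : ℕ) (ht : ¬ t.Holds F σ)
      (hd : Exec F d σ τ n) : Exec F (.branch t c d) σ τ (t.cost + n)
  | loop_stop (t : Cond) (c : Program) (σ : Store) (ht : ¬ t.Holds F σ) :
      Exec F (.loop t c) σ σ t.cost
  | loop_step (t : Cond) (c : Program) (σ τ ρ : Store) (m n : ℕ) (ht : t.Holds F σ)
      (hc : Exec F c σ τ m) (hl : Exec F (.loop t c) τ ρ n) :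
      Exec F (.loop t c) σ ρ (t.cost + m + n)

end RealRAM

/-! ## Divergences and the generalized projection problem -/

/-- `φ : [0, ∞) → [0, ∞]` is a divergence function: convex with `φ 1 = 0`. -/
def IsDivergenceFunction (φ : ℝ≥0 → ℝ≥0∞) : Prop :=
  ConvexOn ℝ≥0 Set.univ φ ∧ φ 1 = 0

/-- The summand `q φ (p / q)` of a `φ`-divergence, with the usual conventions
`0 φ (0 / 0) = 0` and `0 φ (p / 0) = p * lim_{t → ∞} φ t / t`. -/
def divergenceTerm (φ : ℝ≥0 → ℝ≥0∞) (p q : ℝ) : ℝ≥0∞ :=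
  if q = 0 then ENNReal.ofReal p * Filter.limsup (fun t : ℝ≥0 => φ t / (t : ℝ≥0∞)) Filter.atTop
  else ENNReal.ofReal q * φ (Real.toNNReal (p / q))

/-- The `φ`-divergence `d(p, q) = ∑ i, q i φ (p i / q i)`. -/
def divergence (φ : ℝ≥0 → ℝ≥0∞) {S : ℕ} (p q : Fin S → ℝ) : ℝ≥0∞ :=
  ∑ i, divergenceTerm φ (p i) (q i)

/-- The data `(p̄, b, β)` of a generalized projection problem. -/
structure ProjectionInstance where
  S : ℕ
  pbar : Fin S → ℝ
  b : Fin S → ℝ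
  beta : ℝ

namespace ProjectionInstance

/-- The optimal value of: minimize `d(p, p̄)` over `p` in the simplex with `bᵀ p ≤ β`
(equal to `∞` if the problem is infeasible). -/
def value (φ : ℝ≥0 → ℝ≥0∞) (I : ProjectionInstance) : ℝ≥0∞ :=
  ⨅ p ∈ {p : Fin I.S → ℝ | p ∈ stdSimplex ℝ (Fin I.S) ∧ ∑ i, I.b i * p i ≤ I.beta},
    divergence φ p I.pbar

/-- The admissible data: `p̄ ∈ Δ_S`, `b ≥ 0`, `β ≥ 0`, the problem is feasible (`min b ≤ β`) and
not trivially solved by `p̄` (`bᵀ p̄ > β`). -/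
def Admissible (I : ProjectionInstance) : Prop :=
  I.pbar ∈ stdSimplex ℝ (Fin I.S) ∧ (∀ i, 0 ≤ I.b i) ∧ 0 ≤ I.beta ∧
    (∃ i, I.b i ≤ I.beta) ∧ I.beta < ∑ i, I.b i * I.pbar i

/-- The real pair `(dl, du)` solves the projection problem to accuracy `δ`: its optimal value lies
in `[dl, du]`, and `du - dl ≤ δ`. -/
def SolvedBy (φ : ℝ≥0 → ℝ≥0∞) (I : ProjectionInstance) (δ dl du : ℝ) : Prop :=
  I.value φ ≠ ∞ ∧ dl ≤ (I.value φ).toReal ∧ (I.value φ).toReal ≤ du ∧ du - dl ≤ δ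

/-- The input cells hold the projection problem and the accuracy `δ`; all other cells are
arbitrary. -/
def LoadedIn (I : ProjectionInstance) (δ : ℝ) (σ : RealRAM.Store) : Prop :=
  σ.nat 0 0 = I.S ∧ (∀ i : Fin I.S, σ.real 0 i = I.pbar i) ∧ (∀ i : Fin I.S, σ.real 1 i = I.b i) ∧
    σ.real 2 0 = I.beta ∧ σ.real 2 1 = δ

end ProjectionInstance

/-- The program `P` solves every admissible projection problem of the class `𝒟` to every accuracy
`δ > 0` in at most `T δ` steps. The answer is left in the cells `0` and `1` of array `3`. -/
def SolvesProjections (F : ℕ → ℝ → ℝ) (φ : ℝ≥0 → ℝ≥0∞) (P : RealRAM.Program)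
    (𝒟 : Set ProjectionInstance) (T : ℝ → ℝ) : Prop :=
  ∀ I ∈ 𝒟, I.Admissible → ∀ δ : ℝ, 0 < δ → ∀ σ : RealRAM.Store, I.LoadedIn δ σ →
    ∃ (τ : RealRAM.Store) (n : ℕ), RealRAM.Exec F P σ τ n ∧ (n : ℝ) ≤ T δ ∧
      I.SolvedBy φ δ (τ.real 3 0) (τ.real 3 1)

/-! ## Robust Markov decision processes with additive divergence ambiguity sets -/

/-- A robust Markov decision process with `S` states and `A` actions: nominal transition
probabilities, rewards, discount factor and uncertainty budget. -/
structure RobustMDP (S A : ℕ) where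
  pbar : Fin S → Fin A → Fin S → ℝ
  r : Fin S → Fin A → Fin S → ℝ
  lam : ℝ
  kappa : ℝ
  pbar_mem : ∀ s a, pbar s a ∈ stdSimplex ℝ (Fin S)
  r_nonneg : ∀ s a s', 0 ≤ r s a s'
  lam_pos : 0 < lam
  lam_lt_one : lam < 1
  kappa_pos : 0 < kappa

namespace RobustMDP

variable {S A : ℕ}

/-- The ambiguity set `𝒫_s`: all `p_s ∈ (Δ_S)^A` with `∑ a, d(p_sa, p̄_sa) ≤ κ`. -/
def ambiguitySet (M : RobustMDP S A) (φ : ℝ≥0 → ℝ≥0∞) (s : Fin S) : Set (Fin A → Fin S → ℝ) :=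
  {p | (∀ a, p a ∈ stdSimplex ℝ (Fin S)) ∧
    ∑ a, divergence φ (p a) (M.pbar s a) ≤ ENNReal.ofReal M.kappa}

/-- The vector `r_sa + λ v`. -/
def payoff (M : RobustMDP S A) (v : Fin S → ℝ) (s : Fin S) (a : Fin A) : Fin S → ℝ :=
  fun s' => M.r s a s' + M.lam * v s'

/-- The robust Bellman operator
`[𝔍(v)]_s = max_{π ∈ Δ_A} min_{p ∈ 𝒫_s} ∑ a, π_a p_aᵀ (r_sa + λ v)`. -/
def bellman (M : RobustMDP S A) (φ : ℝ≥0 → ℝ≥0∞) (v : Fin S → ℝ) (s : Fin S) : ℝ :=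
  ⨆ π : stdSimplex ℝ (Fin A), ⨅ p : M.ambiguitySet φ s,
    ∑ a, (π : Fin A → ℝ) a * ∑ s', (p : Fin A → Fin S → ℝ) a s' * M.payoff v s a s'

/-- `R̄ = (1 - λ)⁻¹ max r`. -/
def Rbar (M : RobustMDP S A) : ℝ :=
  (1 - M.lam)⁻¹ * ⨆ x : Fin S × Fin A × Fin S, M.r x.1 x.2.1 x.2.2

/-- The projection problem of the state-action pair `(s, a)` at the level `β`. -/
def projection (M : RobustMDP S A) (v : Fin S → ℝ) (s : Fin S) (a : Fin A) (β : ℝ) :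
    ProjectionInstance where
  S := S
  pbar := M.pbar s a
  b := M.payoff v s a
  beta := β

/-- The input cells hold the process (three-dimensional tables are stored row by row), the current
value vector `v` and the accuracy `ε`; all other cells are arbitrary. -/
def LoadedIn (M : RobustMDP S A) (v : Fin S → ℝ) (ε : ℝ) (σ : RealRAM.Store) : Prop :=
  σ.nat 0 0 = S ∧ σ.nat 0 1 = A ∧
    (∀ (s : Fin S) (a : Fin A) (s' : Fin S),
      σ.real 0 (((s : ℕ) * A + a) * S + s') = M.pbar s a s') ∧
    (∀ (s : Fin S) (a : Fin A) (s' : Fin S),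
      σ.real 1 (((s : ℕ) * A + a) * S + s') = M.r s a s') ∧
    (∀ s : Fin S, σ.real 2 s = v s) ∧
    σ.real 3 0 = M.lam ∧ σ.real 3 1 = M.kappa ∧ σ.real 3 2 = ε

/-- The program `Q` computes `𝔍(v)` to accuracy `ε` in the maximum norm in at most `T` steps. The
answer is left in the first `S` cells of array `4`. -/
def ComputesBellman (F : ℕ → ℝ → ℝ) (φ : ℝ≥0 → ℝ≥0∞) (Q : RealRAM.Program)
    (M : RobustMDP S A) (v : Fin S → ℝ) (ε T : ℝ) : Prop :=
  ∀ σ : RealRAM.Store, M.LoadedIn v ε σ →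
    ∃ (τ : RealRAM.Store) (n : ℕ), RealRAM.Exec F Q σ τ n ∧ (n : ℝ) ≤ T ∧
      ∀ s : Fin S, |τ.real 4 s - M.bellman φ v s| ≤ ε

/-- The accuracy `ε κ / (2 A R̄ + A ε)` to which the projection problems are solved. -/
def projectionAccuracy (M : RobustMDP S A) (ε : ℝ) : ℝ :=
  ε * M.kappa / (2 * A * M.Rbar + A * ε)

end RobustMDP

end

/-!
By the minimax theorem, the robust Bellman update of a state `s` is
`θ = inf_p max_a p_aᵀ b_a`, where `b_a = r_sa + λ v` and `p` ranges over the ambiguity set. Only the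
policies range over a compact set, and the infimum need not be attained; the nontrivial half
`RobustMDP.le_bellman` follows by separating the convex set of attainable payoff vectors from an
open orthant. Hence a level `β` is compared with `θ` by comparing the sum over `a` of the
projection distances `𝔓(p̄_a; b_a, β)` with the budget `κ`, and `θ` is found by bisection.

The distances are only known up to `δ* = ε κ / (2 A R̄ + A ε)`. If the sum of the lower bounds
exceeds `κ`, then `β ≤ θ` (`RobustMDP.le_bellman_of_lt_sum_value`). Otherwise there are
distributions with `p_aᵀ b_a ≤ β` that exceed the budget by at most little more than `A δ*`; by
convexity of the divergence, moving them towards `p̄` brings them into the ambiguity set, and costs at most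
`ε / 2` since payoffs are at most `R̄`. So `θ ≤ β + ε / 2`
(`RobustMDP.bellman_le_of_sum_value_le`).

The bisection starts from `max_a min b_a` and `max_a b_aᵀ p̄_a`, both in `[0, R̄]`, and stops once
the interval is no longer than `ε`. Every level tested is then at least `min b_a + ε / 2` for all
`a`. A level that is at least `b_aᵀ p̄_a` has distance `0` for the action `a`, and the projection
program is not called. So only problems of the given class are solved, and the true value lies in an
interval of length at most `3 ε / 2`, whose midpoint is the answer.

Arrays are named statically, so the projection program `P` writes only arrays below some `N`. The
program `RealRAM.bellmanProgram` first copies its input to higher arrays. Its correctness and its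
running time are derived in a small program logic for the predicate `RealRAM.Runs`; the arrays that
a program does not write are carried along by `RealRAM.Program.Frame`.
-/

namespace RealRAM

/-! ### Time-bounded total correctness -/

namespace Store

@[simp] lemma setNat_real (σ : Store) (k i x : ℕ) : (σ.setNat k i x).real = σ.real := rfl

@[simp] lemma setReal_nat (σ : Store) (k i : ℕ) (x : ℝ) : (σ.setReal k i x).nat = σ.nat := rfl

lemma setNat_nat (σ : Store) (k i x k' j : ℕ) :
    (σ.setNat k i x).nat k' j = if k' = k ∧ j = i then x else σ.nat k' j := by
  by_cases hk : k' = k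
  · subst hk; simp [setNat, Function.update_apply]
  · simp [setNat, hk]

lemma setReal_real (σ : Store) (k i : ℕ) (x : ℝ) (k' j : ℕ) :
    (σ.setReal k i x).real k' j = if k' = k ∧ j = i then x else σ.real k' j := by
  by_cases hk : k' = k
  · subst hk; simp [setReal, Function.update_apply]
  · simp [setReal, hk]

end Store

/-- The `k`-th array of natural numbers occurs as the target of an assignment in the program. -/
def Program.WritesNat : Program → ℕ → Prop
  | .skip, _ => False
  | .setNat k _ _, j => j = k
  | .setReal _ _ _, _ => False
  | .seq c d, j => c.WritesNat j ∨ d.WritesNat j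
  | .branch _ c d, j => c.WritesNat j ∨ d.WritesNat j
  | .loop _ c, j => c.WritesNat j

/-- The `k`-th array of real numbers occurs as the target of an assignment in the program. -/
def Program.WritesReal : Program → ℕ → Prop
  | .skip, _ => False
  | .setNat _ _ _, _ => False
  | .setReal k _ _, j => j = k
  | .seq c d, j => c.WritesReal j ∨ d.WritesReal j
  | .branch _ c d, j => c.WritesReal j ∨ d.WritesReal j
  | .loop _ c, j => c.WritesReal j

/-- Since arrays are named statically, a program leaves almost all arrays alone. -/
lemma Program.exists_writes_lt (c : Program) :
    ∃ N, ∀ k, (c.WritesNat k ∨ c.WritesReal k) → k < N := by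
  induction c with
  | skip => exact ⟨0, by simp [WritesNat, WritesReal]⟩
  | setNat k _ _ => exact ⟨k + 1, by simp [WritesNat, WritesReal]⟩
  | setReal k _ _ => exact ⟨k + 1, by simp [WritesNat, WritesReal]⟩
  | seq c d hc hd | branch _ c d hc hd =>
    obtain ⟨M, hM⟩ := hc
    obtain ⟨N, hN⟩ := hd
    refine ⟨max M N, fun k hk => lt_max_iff.2 ?_⟩
    simp only [WritesNat, WritesReal] at hk
    have := hM k
    have := hN k
    tauto
  | loop _ c hc => exact hc

/-- The two stores agree on every array that the program does not write. -/
structure Program.Frame (c : Program) (σ τ : Store) : Prop where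
  nat : ∀ k, ¬ c.WritesNat k → τ.nat k = σ.nat k
  real : ∀ k, ¬ c.WritesReal k → τ.real k = σ.real k

lemma Program.Frame.refl (c : Program) (σ : Store) : c.Frame σ σ := ⟨fun _ _ => rfl, fun _ _ => rfl⟩

variable {F : ℕ → ℝ → ℝ} {c d : Program} {σ τ ρ : Store} {T T' n : ℕ} {Post Post' : Store → Prop}

lemma Program.Frame.trans (h : c.Frame σ τ) (h' : c.Frame τ ρ) : c.Frame σ ρ :=
  ⟨fun k hk => (h'.nat k hk).trans (h.nat k hk), fun k hk => (h'.real k hk).trans (h.real k hk)⟩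

lemma Program.Frame.setNat {k i x : ℕ} (h : c.Frame σ τ) (hk : c.WritesNat k) :
    c.Frame σ (τ.setNat k i x) :=
  ⟨fun j hj => (Function.update_of_ne (by rintro rfl; exact hj hk) _ _).trans (h.nat j hj), h.real⟩

lemma Program.Frame.setReal {k i : ℕ} {x : ℝ} (h : c.Frame σ τ) (hk : c.WritesReal k) :
    c.Frame σ (τ.setReal k i x) :=
  ⟨h.nat, fun j hj => (Function.update_of_ne (by rintro rfl; exact hj hk) _ _).trans (h.real j hj)⟩

lemma Program.Frame.mono (h : c.Frame σ τ) (hn : ∀ k, c.WritesNat k → d.WritesNat k)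
    (hr : ∀ k, c.WritesReal k → d.WritesReal k) : d.Frame σ τ :=
  ⟨fun k hk => h.nat k (mt (hn k) hk), fun k hk => h.real k (mt (hr k) hk)⟩

/-- An execution changes only the arrays that the program writes. -/
lemma Exec.frame (h : Exec F c σ τ n) : c.Frame σ τ := by
  induction h with
  | skip σ => exact .refl _ _
  | setNat k i e σ =>
    exact ⟨fun j hj => Function.update_of_ne hj _ _, fun _ _ => rfl⟩
  | setReal k i e σ =>
    exact ⟨fun _ _ => rfl, fun j hj => Function.update_of_ne hj _ _⟩
  | seq c d _ _ _ _ _ _ _ hc hd =>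
    exact (hc.mono (fun _ => Or.inl) fun _ => Or.inl).trans
      (hd.mono (fun _ => Or.inr) fun _ => Or.inr)
  | branch_pos t c d _ _ _ _ _ hc => exact hc.mono (fun _ => Or.inl) fun _ => Or.inl
  | branch_neg t c d _ _ _ _ _ hd => exact hd.mono (fun _ => Or.inr) fun _ => Or.inr
  | loop_stop => exact .refl _ _
  | loop_step t c _ _ _ _ _ _ _ _ hc hl => exact Program.Frame.trans ⟨hc.nat, hc.real⟩ hl

/-- Started in `σ`, the program halts within `T` steps in a store that satisfies `Post`. -/
def Runs (F : ℕ → ℝ → ℝ) (c : Program) (σ : Store) (T : ℕ) (Post : Store → Prop) : Prop :=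
  ∃ (τ : Store) (n : ℕ), Exec F c σ τ n ∧ n ≤ T ∧ Post τ

namespace Runs

lemma frame (h : Runs F c σ T Post) : Runs F c σ T (fun τ => Post τ ∧ c.Frame σ τ) := by
  obtain ⟨τ, n, he, hn, hp⟩ := h
  exact ⟨τ, n, he, hn, hp, he.frame⟩

lemma mono (h : Runs F c σ T Post) (hT : T ≤ T') (hP : ∀ τ, Post τ → Post' τ) :
    Runs F c σ T' Post' := by
  obtain ⟨τ, n, he, hn, hp⟩ := h
  exact ⟨τ, n, he, hn.trans hT, hP τ hp⟩

lemma mono_time (h : Runs F c σ T Post) (hT : T ≤ T') : Runs F c σ T' Post :=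
  h.mono hT fun _ => id

lemma skip (h : Post σ) : Runs F .skip σ 1 Post := ⟨_, _, .skip σ, le_rfl, h⟩

lemma setNat {k : ℕ} {i e : NExp} (h : Post (σ.setNat k (i.eval σ) (e.eval σ))) :
    Runs F (.setNat k i e) σ (i.cost + e.cost + 1) Post := ⟨_, _, .setNat k i e σ, le_rfl, h⟩

lemma setReal {k : ℕ} {i : NExp} {e : RExp} (h : Post (σ.setReal k (i.eval σ) (e.eval F σ))) :
    Runs F (.setReal k i e) σ (i.cost + e.cost + 1) Post := ⟨_, _, .setReal k i e σ, le_rfl, h⟩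

lemma seq (hc : Runs F c σ T Post) (hd : ∀ τ, Post τ → Runs F d τ T' Post') :
    Runs F (.seq c d) σ (T + T') Post' := by
  obtain ⟨τ, n, he, hn, hp⟩ := hc
  obtain ⟨ρ, m, he', hm, hp'⟩ := hd τ hp
  exact ⟨ρ, n + m, .seq _ _ _ _ _ _ _ he he', by omega, hp'⟩

lemma setNat_seq {k : ℕ} {i e : NExp} (h : Runs F d (σ.setNat k (i.eval σ) (e.eval σ)) T Post) :
    Runs F (.seq (.setNat k i e) d) σ (i.cost + e.cost + 1 + T) Post :=
  (setNat (Post := (· = σ.setNat k (i.eval σ) (e.eval σ))) rfl).seq fun _ hτ => hτ ▸ h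

lemma setReal_seq {k : ℕ} {i : NExp} {e : RExp}
    (h : Runs F d (σ.setReal k (i.eval σ) (e.eval F σ)) T Post) :
    Runs F (.seq (.setReal k i e) d) σ (i.cost + e.cost + 1 + T) Post :=
  (setReal (Post := (· = σ.setReal k (i.eval σ) (e.eval F σ))) rfl).seq fun _ hτ => hτ ▸ h

lemma branch {t : Cond} (hc : t.Holds F σ → Runs F c σ T Post)
    (hd : ¬ t.Holds F σ → Runs F d σ T Post) : Runs F (.branch t c d) σ (t.cost + T) Post := by
  by_cases ht : t.Holds F σ
  · obtain ⟨τ, n, he, hn, hp⟩ := hc ht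
    exact ⟨τ, _, .branch_pos _ _ _ _ _ _ ht he, by omega, hp⟩
  · obtain ⟨τ, n, he, hn, hp⟩ := hd ht
    exact ⟨τ, _, .branch_neg _ _ _ _ _ _ ht he, by omega, hp⟩

/-- The index of the invariant bounds the number of remaining iterations. -/
lemma loop {t : Cond} {Inv : ℕ → Store → Prop} (h0 : ∀ τ, Inv 0 τ → ¬ t.Holds F τ)
    (step : ∀ k τ, Inv (k + 1) τ → t.Holds F τ → c.Frame σ τ → Runs F c τ T (Inv k))
    {k : ℕ} (hk : Inv k σ) :
    Runs F (.loop t c) σ (k * (T + t.cost) + t.cost) (fun τ => (∃ j, Inv j τ) ∧ ¬ t.Holds F τ) := by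
  have key : ∀ k τ, Inv k τ → c.Frame σ τ → Runs F (.loop t c) τ (k * (T + t.cost) + t.cost)
      (fun τ => (∃ j, Inv j τ) ∧ ¬ t.Holds F τ) := by
    intro k
    induction k with
    | zero =>
      intro τ hτ _
      exact ⟨τ, _, Exec.loop_stop _ _ _ (h0 τ hτ), by simp, ⟨0, hτ⟩, h0 τ hτ⟩
    | succ k ih =>
      intro τ hτ hf
      by_cases ht : t.Holds F τ
      · obtain ⟨ρ, n, he, hn, hp, hf'⟩ := (step k τ hτ ht hf).frame
        obtain ⟨υ, m, he', hm, hp'⟩ := ih ρ hp (hf.trans hf')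
        refine ⟨υ, _, .loop_step _ _ _ _ _ _ _ ht he he', ?_, hp'⟩
        rw [add_one_mul]
        omega
      · exact ⟨τ, _, Exec.loop_stop _ _ _ ht, by omega, ⟨_, hτ⟩, ht⟩
  exact key k σ hk (.refl _ _)

end Runs

/-- A loop in which entry `0` of the counter array `i` runs from `0` up to the value (exclusive)
of entry `0` of array `b`. -/
def forLoop (i b : ℕ) (c : Program) : Program :=
  .seq (.setNat i (.lit 0) (.lit 0))
    (.loop (.ltNat (.get i (.lit 0)) (.get b (.lit 0)))
      (.seq c (.setNat i (.lit 0) (.add (.get i (.lit 0)) (.lit 1)))))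

@[simp] lemma writesNat_forLoop (i b k : ℕ) :
    (forLoop i b c).WritesNat k ↔ k = i ∨ c.WritesNat k := by
  simp only [forLoop, Program.WritesNat]; tauto

@[simp] lemma writesReal_forLoop (i b k : ℕ) :
    (forLoop i b c).WritesReal k ↔ c.WritesReal k := by
  simp [forLoop, Program.WritesReal]

lemma Runs.forLoop {i b m : ℕ} {Inv : ℕ → Store → Prop} (hib : i ≠ b) (hi : ¬ c.WritesNat i)
    (hb : ¬ c.WritesNat b) (hm : σ.nat b 0 = m) (h0 : Inv 0 (σ.setNat i 0 0))
    (step : ∀ k < m, ∀ τ, Inv k τ → τ.nat i 0 = k → (forLoop i b c).Frame σ τ →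
      Runs F c τ T (fun ρ => Inv (k + 1) (ρ.setNat i 0 (k + 1)))) :
    Runs F (forLoop i b c) σ (m * (T + 11) + 8) (Inv m) := by
  have hfr : (RealRAM.forLoop i b c).Frame σ (σ.setNat i 0 0) :=
    (Program.Frame.refl _ _).setNat (by simp)
  refine Runs.mono (Runs.setNat_seq (Runs.loop (T := T + 6) (k := m)
    (Inv := fun j τ => ∃ k, k + j = m ∧ τ.nat i 0 = k ∧ τ.nat b 0 = m ∧ Inv k τ)
    ?_ ?_ ?_)) (T' := m * (T + 11) + 8) ?_ ?_
  · rintro τ ⟨k, hk, h1, h2, -⟩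
    simp [Cond.Holds, NExp.eval, h1, h2]; omega
  · rintro j τ ⟨k, hk, h1, h2, hI⟩ - hf
    have hf' : (RealRAM.forLoop i b c).Frame σ τ := hfr.trans <| hf.mono
      (by simp [Program.WritesNat]; tauto) (by simp [Program.WritesReal])
    refine Runs.seq (step k (by omega) τ hI h1 hf').frame (fun ρ hρ => ?_)
    obtain ⟨hρ, hfρ⟩ := hρ
    refine Runs.setNat ?_
    have e1 : ρ.nat i 0 = k := by rw [hfρ.nat i hi, h1]
    have e2 : ρ.nat b 0 = m := by rw [hfρ.nat b hb, h2]
    refine ⟨k + 1, by omega, ?_, ?_, ?_⟩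
    · simp [NExp.eval, Store.setNat_nat, e1]
    · simp [NExp.eval, Store.setNat_nat, hib.symm, e2]
    · simpa [NExp.eval, e1] using hρ
  · refine ⟨0, by simp, by simp [NExp.eval, Store.setNat_nat], ?_, by simpa [NExp.eval] using h0⟩
    simp [NExp.eval, Store.setNat_nat, hib.symm, hm]
  · simp only [NExp.cost, Cond.cost]
    ring_nf; omega
  · rintro τ ⟨⟨j, k, hk, h1, h2, hI⟩, ht⟩
    simp only [Cond.Holds, NExp.eval, h1, h2] at ht
    obtain rfl : k = m := by omega
    exact hI

end RealRAM

/-! ### Convexity of the divergence -/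

section Divergence

variable {φ : ℝ≥0 → ℝ≥0∞}

lemma divergenceTerm_convex (hφ : IsDivergenceFunction φ) {p p' q t u : ℝ} (hp : 0 ≤ p)
    (hp' : 0 ≤ p') (hq : 0 ≤ q) (ht : 0 ≤ t) (hu : 0 ≤ u) (htu : t + u = 1) :
    divergenceTerm φ (t * p + u * p') q ≤
      ENNReal.ofReal t * divergenceTerm φ p q + ENNReal.ofReal u * divergenceTerm φ p' q := by
  unfold divergenceTerm
  split_ifs with h
  · rw [ENNReal.ofReal_add (by positivity) (by positivity), ENNReal.ofReal_mul ht,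
      ENNReal.ofReal_mul hu, add_mul, mul_assoc, mul_assoc]
  · have e : Real.toNNReal ((t * p + u * p') / q) =
        t.toNNReal • (p / q).toNNReal + u.toNNReal • (p' / q).toNNReal := by
      rw [smul_eq_mul, smul_eq_mul, ← Real.toNNReal_mul ht, ← Real.toNNReal_mul hu,
        ← Real.toNNReal_add (by positivity) (by positivity)]
      congr 1; ring
    have := hφ.1.2 (Set.mem_univ (p / q).toNNReal) (Set.mem_univ (p' / q).toNNReal)
      (zero_le : 0 ≤ t.toNNReal) (zero_le : 0 ≤ u.toNNReal)
      (by rw [← Real.toNNReal_add ht hu, htu, Real.toNNReal_one])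
    rw [e]
    calc _ ≤ ENNReal.ofReal q * (t.toNNReal • φ (p / q).toNNReal
            + u.toNNReal • φ (p' / q).toNNReal) := by gcongr
      _ = _ := by
        rw [ENNReal.smul_def, ENNReal.smul_def, smul_eq_mul, smul_eq_mul]
        change ENNReal.ofReal q * (ENNReal.ofReal t * _ + ENNReal.ofReal u * _) = _
        ring

lemma divergence_convex (hφ : IsDivergenceFunction φ) {S : ℕ} {p p' q : Fin S → ℝ} {t u : ℝ}
    (hp : ∀ i, 0 ≤ p i) (hp' : ∀ i, 0 ≤ p' i) (hq : ∀ i, 0 ≤ q i) (ht : 0 ≤ t) (hu : 0 ≤ u)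
    (htu : t + u = 1) :
    divergence φ (fun i => t * p i + u * p' i) q ≤
      ENNReal.ofReal t * divergence φ p q + ENNReal.ofReal u * divergence φ p' q := by
  unfold divergence
  rw [Finset.mul_sum, Finset.mul_sum, ← Finset.sum_add_distrib]
  exact Finset.sum_le_sum fun i _ => divergenceTerm_convex hφ (hp i) (hp' i) (hq i) ht hu htu

lemma divergence_self (hφ : IsDivergenceFunction φ) {S : ℕ} (q : Fin S → ℝ) :
    divergence φ q q = 0 := by
  unfold divergence divergenceTerm
  refine Finset.sum_eq_zero fun i _ => ?_
  split_ifs with h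
  · simp [h]
  · simp [div_self h, hφ.2]

end Divergence

namespace RobustMDP

variable {S A : ℕ} {φ : ℝ≥0 → ℝ≥0∞} (M : RobustMDP S A) (v : Fin S → ℝ) (s : Fin S)

lemma convex_ambiguitySet (hφ : IsDivergenceFunction φ) : Convex ℝ (M.ambiguitySet φ s) := by
  rintro p ⟨hp, hpd⟩ p' ⟨hp', hpd'⟩ t u ht hu htu
  refine ⟨fun a => convex_stdSimplex ℝ (Fin S) (hp a) (hp' a) ht hu htu, ?_⟩
  calc ∑ a, divergence φ ((t • p + u • p') a) (M.pbar s a)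
      ≤ ∑ a, (ENNReal.ofReal t * divergence φ (p a) (M.pbar s a)
          + ENNReal.ofReal u * divergence φ (p' a) (M.pbar s a)) :=
        Finset.sum_le_sum fun a _ => divergence_convex hφ (hp a).1 (hp' a).1 (M.pbar_mem s a).1
          ht hu htu
    _ = ENNReal.ofReal t * ∑ a, divergence φ (p a) (M.pbar s a)
          + ENNReal.ofReal u * ∑ a, divergence φ (p' a) (M.pbar s a) := by
        rw [Finset.sum_add_distrib, Finset.mul_sum, Finset.mul_sum]
    _ ≤ ENNReal.ofReal t * ENNReal.ofReal M.kappa + ENNReal.ofReal u * ENNReal.ofReal M.kappa := by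
        gcongr
    _ = ENNReal.ofReal M.kappa := by
        rw [← add_mul, ← ENNReal.ofReal_add ht hu, htu, ENNReal.ofReal_one, one_mul]

lemma pbar_mem_ambiguitySet (hφ : IsDivergenceFunction φ) : M.pbar s ∈ M.ambiguitySet φ s :=
  ⟨M.pbar_mem s, by simp [divergence_self hφ]⟩

/-- A family of distributions that exceeds the budget by `x` is brought into the ambiguity set by
moving it towards the nominal distributions with weight `x / (κ + x)`. -/
lemma mix_mem_ambiguitySet (hφ : IsDivergenceFunction φ) {p : Fin A → Fin S → ℝ} {x : ℝ}
    (hx : 0 ≤ x) (hp : ∀ a, p a ∈ stdSimplex ℝ (Fin S))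
    (hd : ∑ a, divergence φ (p a) (M.pbar s a) ≤ ENNReal.ofReal (M.kappa + x)) :
    (fun a i => M.kappa / (M.kappa + x) * p a i + x / (M.kappa + x) * M.pbar s a i)
      ∈ M.ambiguitySet φ s := by
  have hκ := M.kappa_pos
  have ht : 0 ≤ M.kappa / (M.kappa + x) := by positivity
  have hu : 0 ≤ x / (M.kappa + x) := by positivity
  have htu : M.kappa / (M.kappa + x) + x / (M.kappa + x) = 1 := by field_simp
  refine ⟨fun a => convex_stdSimplex ℝ (Fin S) (hp a) (M.pbar_mem s a) ht hu htu, ?_⟩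
  calc _ ≤ ∑ a, (ENNReal.ofReal (M.kappa / (M.kappa + x)) * divergence φ (p a) (M.pbar s a)
          + ENNReal.ofReal (x / (M.kappa + x)) * divergence φ (M.pbar s a) (M.pbar s a)) :=
        Finset.sum_le_sum fun a _ => divergence_convex hφ (hp a).1 (M.pbar_mem s a).1
          (M.pbar_mem s a).1 ht hu htu
    _ = ENNReal.ofReal (M.kappa / (M.kappa + x)) * ∑ a, divergence φ (p a) (M.pbar s a) := by
        simp [divergence_self hφ, Finset.mul_sum]
    _ ≤ ENNReal.ofReal (M.kappa / (M.kappa + x)) * ENNReal.ofReal (M.kappa + x) := by gcongr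
    _ = ENNReal.ofReal M.kappa := by
        rw [← ENNReal.ofReal_mul ht]; congr 1; field_simp

/-! ### The robust Bellman update as a minimax value -/

lemma reward_le (a : Fin A) (s' : Fin S) :
    M.r s a s' ≤ ⨆ x : Fin S × Fin A × Fin S, M.r x.1 x.2.1 x.2.2 :=
  le_ciSup (f := fun x : Fin S × Fin A × Fin S => M.r x.1 x.2.1 x.2.2)
    (Set.finite_range _).bddAbove (s, a, s')

lemma Rbar_nonneg : 0 ≤ M.Rbar :=
  mul_nonneg (inv_nonneg.2 (by linarith [M.lam_lt_one]))
    (Real.iSup_nonneg fun _ => M.r_nonneg _ _ _)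

variable {v}

lemma payoff_le_Rbar (hv : ∀ s, v s ≤ M.Rbar) (a : Fin A) (s' : Fin S) :
    M.payoff v s a s' ≤ M.Rbar := by
  have h1 : (1 - M.lam) * M.Rbar = ⨆ x : Fin S × Fin A × Fin S, M.r x.1 x.2.1 x.2.2 := by
    have : 1 - M.lam ≠ 0 := by linarith [M.lam_lt_one]
    simp [Rbar, this]
  have h2 := M.reward_le s a s'
  have h3 := mul_le_mul_of_nonneg_left (hv s') M.lam_pos.le
  unfold payoff
  linarith

lemma sum_mul_le_of_mem_stdSimplex {p b : Fin S → ℝ} {x : ℝ} (hp : p ∈ stdSimplex ℝ (Fin S))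
    (h : ∀ i, b i ≤ x) : ∑ i, p i * b i ≤ x := by
  calc ∑ i, p i * b i ≤ ∑ i, p i * x := 
        Finset.sum_le_sum fun i _ => mul_le_mul_of_nonneg_left (h i) (hp.1 i)
    _ = x := by rw [← Finset.sum_mul, hp.2, one_mul]

lemma le_sum_mul_of_mem_stdSimplex {p b : Fin S → ℝ} {x : ℝ} (hp : p ∈ stdSimplex ℝ (Fin S))
    (h : ∀ i, x ≤ b i) : x ≤ ∑ i, p i * b i := by
  calc x = ∑ i, p i * x := by rw [← Finset.sum_mul, hp.2, one_mul]
    _ ≤ ∑ i, p i * b i :=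
        Finset.sum_le_sum fun i _ => mul_le_mul_of_nonneg_left (h i) (hp.1 i)

section Minimax

variable (hb : ∀ s a s', 0 ≤ M.payoff v s a s')
include hb

lemma bddBelow_range_expected (π : stdSimplex ℝ (Fin A)) :
    BddBelow (Set.range fun p : M.ambiguitySet φ s =>
      ∑ a, (π : Fin A → ℝ) a * ∑ s', (p : Fin A → Fin S → ℝ) a s' * M.payoff v s a s') := by
  refine ⟨0, ?_⟩
  rintro _ ⟨p, rfl⟩
  exact Finset.sum_nonneg fun a _ => mul_nonneg (π.2.1 a) <| Finset.sum_nonneg fun i _ =>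
    mul_nonneg ((p.2.1 a).1 i) (hb _ _ _)

/-- A single element of the ambiguity set bounds the robust Bellman update from above. -/
lemma bellman_le (hA : 0 < A) {p : Fin A → Fin S → ℝ} (hp : p ∈ M.ambiguitySet φ s) {θ : ℝ}
    (h : ∀ a, ∑ s', p a s' * M.payoff v s a s' ≤ θ) : M.bellman φ v s ≤ θ := by
  have : Nonempty (Fin A) := ⟨⟨0, hA⟩⟩
  have : Nonempty (stdSimplex ℝ (Fin A)) := inferInstance
  refine ciSup_le fun π => (ciInf_le (M.bddBelow_range_expected s hb π) ⟨p, hp⟩).trans ?_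
  exact sum_mul_le_of_mem_stdSimplex π.2 h

/-- The nontrivial half of the minimax theorem: if no element of the ambiguity set keeps the
expected payoffs of all actions below `θ`, some randomized policy guarantees `θ`. The policy is
the normal of a hyperplane that separates the attainable payoff vectors from the open orthant
below `(θ, …, θ)`. -/
lemma le_bellman (hφ : IsDivergenceFunction φ) (hv : ∀ s, v s ≤ M.Rbar) {θ : ℝ}
    (h : ∀ p ∈ M.ambiguitySet φ s, ∃ a, θ ≤ ∑ s', p a s' * M.payoff v s a s') :
    θ ≤ M.bellman φ v s := by
  classical
  have hne : Nonempty (M.ambiguitySet φ s) := ⟨⟨_, M.pbar_mem_ambiguitySet s hφ⟩⟩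
  let L : (Fin A → Fin S → ℝ) →ₗ[ℝ] (Fin A → ℝ) :=
    { toFun := fun p a => ∑ s', p a s' * M.payoff v s a s'
      map_add' := fun p q => by ext a; simp [add_mul, Finset.sum_add_distrib]
      map_smul' := fun t p => by ext a; simp [Finset.mul_sum, mul_assoc] }
  have hdisj : Disjoint (Set.univ.pi fun _ : Fin A => Set.Iio θ) (L '' M.ambiguitySet φ s) := by
    rw [Set.disjoint_left]
    rintro _ hx ⟨p, hp, rfl⟩
    obtain ⟨a, ha⟩ := h p hp
    exact absurd ha (not_le.2 (hx a (Set.mem_univ a)))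
  obtain ⟨f, u, hf, hu⟩ := geometric_hahn_banach_open
    (convex_pi fun _ _ => convex_Iio θ) (isOpen_set_pi Set.finite_univ fun _ _ => isOpen_Iio)
    ((M.convex_ambiguitySet s hφ).linear_image L) hdisj
  set w : Fin A → ℝ := fun a => f (Pi.single a 1) with hw
  have hfw : ∀ x, f x = ∑ a, w a * x a := by
    intro x
    conv_lhs => rw [← Finset.univ_sum_single x]
    rw [map_sum]
    refine Finset.sum_congr rfl fun a _ => ?_
    have : (Pi.single a (x a) : Fin A → ℝ) = x a • Pi.single a 1 := by
      rw [← Pi.single_smul]; simp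
    rw [this, map_smul, smul_eq_mul, mul_comm]
  have hlt : ∀ x : Fin A → ℝ, (∀ a, x a < θ) → ∑ a, w a * x a < u := fun x hx => by
    rw [← hfw]; exact hf x fun a _ => hx a
  have hge : ∀ p ∈ M.ambiguitySet φ s, u ≤ ∑ a, w a * ∑ s', p a s' * M.payoff v s a s' :=
    fun p hp => by have := hu _ ⟨p, hp, rfl⟩; rwa [hfw] at this
  -- The orthant is unbounded in every negative direction, so the normal is nonnegative.
  have hw0 : ∀ a, 0 ≤ w a := by
    intro a
    by_contra! hneg
    set c := ∑ a, w a * (θ - 1)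
    have hc := hlt (fun _ => θ - 1) fun _ => by linarith
    have := hlt (fun a' => (θ - 1) - if a' = a then (u - c) / (-w a) else 0) fun a' => by
      have : 0 ≤ (u - c) / (-w a) := div_nonneg (by linarith) (by linarith)
      split_ifs <;> linarith
    simp only [mul_sub, Finset.sum_sub_distrib, mul_ite, mul_zero, Finset.sum_ite_eq',
      Finset.mem_univ, if_true] at this
    have e : w a * ((u - c) / (-w a)) = -(u - c) := by
      have := hneg.ne
      field_simp
    rw [e] at this
    have hc' : ∑ a, w a * θ - ∑ a, w a * 1 = c := by
      rw [← Finset.sum_sub_distrib]; exact Finset.sum_congr rfl fun _ _ => by ring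
    linarith
  set W := ∑ a, w a with hW
  have hW0 : 0 < W := by
    refine (Finset.sum_nonneg fun a _ => hw0 a).lt_of_ne fun h0 => ?_
    have hz : ∀ a, w a = 0 := fun a =>
      (Finset.sum_eq_zero_iff_of_nonneg fun a _ => hw0 a).1 h0.symm a (Finset.mem_univ a)
    have h1 := hlt (fun _ => θ - 1) fun _ => by linarith
    have h2 := hge _ (M.pbar_mem_ambiguitySet s hφ)
    simp only [hz, zero_mul, Finset.sum_const_zero] at h1 h2
    linarith
  have hθ : θ ≤ u / W := by
    refine le_of_forall_lt fun y hy => ?_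
    have := hlt (fun _ => y) fun _ => hy
    rw [← Finset.sum_mul] at this
    rw [lt_div_iff₀ hW0]; linarith
  have hmem : (fun a => w a / W) ∈ stdSimplex ℝ (Fin A) :=
    ⟨fun a => div_nonneg (hw0 a) hW0.le, by rw [← Finset.sum_div, div_self hW0.ne']⟩
  have hbdd : BddAbove (Set.range fun π : stdSimplex ℝ (Fin A) => ⨅ p : M.ambiguitySet φ s,
      ∑ a, (π : Fin A → ℝ) a * ∑ s', (p : Fin A → Fin S → ℝ) a s' * M.payoff v s a s') := by
    refine ⟨M.Rbar, ?_⟩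
    rintro _ ⟨π, rfl⟩
    refine (ciInf_le (M.bddBelow_range_expected s hb π) hne.some).trans ?_
    exact sum_mul_le_of_mem_stdSimplex π.2 fun a =>
      sum_mul_le_of_mem_stdSimplex (hne.some.2.1 a) fun i => M.payoff_le_Rbar s hv a i
  refine le_ciSup_of_le hbdd ⟨_, hmem⟩ (le_ciInf fun p => ?_)
  refine hθ.trans ?_
  rw [div_le_iff₀ hW0, Finset.sum_mul]
  refine (hge p p.2).trans_eq (Finset.sum_congr rfl fun a _ => ?_)
  change w a * _ = w a / W * _ * W
  field_simp

/-! ### Testing a level by projections -/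

omit hb in
lemma value_projection_eq_zero (hφ : IsDivergenceFunction φ) {a : Fin A} {β : ℝ}
    (h : ∑ i, M.payoff v s a i * M.pbar s a i ≤ β) : (M.projection v s a β).value φ = 0 := by
  refine le_antisymm ?_ zero_le
  refine (iInf₂_le (M.pbar s a) ⟨M.pbar_mem s a, h⟩).trans ?_
  exact (divergence_self hφ _).le

/-- If the projection distances at the level `β` add up to more than the budget, the level is a
lower bound. -/
lemma le_bellman_of_lt_sum_value (hφ : IsDivergenceFunction φ) (hv : ∀ s, v s ≤ M.Rbar) {β : ℝ}
    {y : Fin A → ℝ} (hfin : ∀ a, (M.projection v s a β).value φ ≠ ∞)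
    (hy : ∀ a, y a ≤ ((M.projection v s a β).value φ).toReal) (hκ : M.kappa < ∑ a, y a) :
    β ≤ M.bellman φ v s := by
  refine M.le_bellman s hb hφ hv fun p hp => ?_
  by_contra! hlt
  have h1 : ∑ a, (M.projection v s a β).value φ ≤ ENNReal.ofReal M.kappa := by
    refine le_trans (Finset.sum_le_sum fun a _ => ?_) hp.2
    refine iInf₂_le (p a) ⟨hp.1 a, ?_⟩
    refine (le_of_eq ?_).trans (hlt a).le
    exact Finset.sum_congr rfl fun i _ => mul_comm _ _
  have h2 := ENNReal.toReal_mono ENNReal.ofReal_ne_top h1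
  rw [ENNReal.toReal_sum fun a _ => hfin a, ENNReal.toReal_ofReal M.kappa_pos.le] at h2
  linarith [Finset.sum_le_sum fun a (_ : a ∈ Finset.univ) => hy a]

omit hb in
lemma projectionAccuracy_pos (hA : 0 < A) {ε : ℝ} (hε : 0 < ε) : 0 < M.projectionAccuracy ε := by
  have := M.Rbar_nonneg
  have := M.kappa_pos
  have : (0 : ℝ) < A := by exact_mod_cast hA
  unfold projectionAccuracy
  positivity

/-- If the projection distances at the level `β`, known up to the accuracy `δ*`, may add up to at
most the budget, the level exceeds the robust Bellman update, up to an error of `ε / 2`. -/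
lemma bellman_le_of_sum_value_le (hφ : IsDivergenceFunction φ) (hA : 0 < A)
    (hv : ∀ s, v s ≤ M.Rbar) {β ε : ℝ} (hε : 0 < ε)
    {y : Fin A → ℝ} (hfin : ∀ a, (M.projection v s a β).value φ ≠ ∞)
    (hy : ∀ a, ((M.projection v s a β).value φ).toReal ≤ y a + M.projectionAccuracy ε)
    (hκ : ∑ a, y a ≤ M.kappa) :
    M.bellman φ v s ≤ β + ε / 2 := by
  have hR := M.Rbar_nonneg
  have hk := M.kappa_pos
  have hA' : (0 : ℝ) < A := by exact_mod_cast hA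
  set δ := M.projectionAccuracy ε with hδ
  -- Slightly more than `A δ*`, since the projection problems need not have minimizers.
  set x := ε * M.kappa / (2 * M.Rbar + ε / 2) with hx
  have hAδ : δ < x / A := by
    rw [hδ, hx, projectionAccuracy, div_div]
    apply div_lt_div_of_pos_left (by positivity) (by positivity)
    nlinarith
  have hx0 : 0 < x := by positivity
  have hxR : x / (M.kappa + x) * M.Rbar ≤ ε / 2 := by
    rw [div_mul_eq_mul_div, div_le_iff₀ (by positivity)]
    have e : x * (2 * M.Rbar + ε / 2) = ε * M.kappa := by rw [hx]; field_simp
    nlinarith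
  have hex : ∀ a, ∃ p ∈ {p : Fin S → ℝ | p ∈ stdSimplex ℝ (Fin S) ∧
      ∑ i, M.payoff v s a i * p i ≤ β},
        divergence φ p (M.pbar s a) < ENNReal.ofReal (y a + x / A) := by
    intro a
    have h1 : (M.projection v s a β).value φ < ENNReal.ofReal (y a + x / A) := by
      rw [ENNReal.lt_ofReal_iff_toReal_lt (hfin a)]
      linarith [hy a]
    obtain ⟨p, hp⟩ := iInf_lt_iff.1 h1
    obtain ⟨hp, hd⟩ := iInf_lt_iff.1 hp
    exact ⟨p, hp, hd⟩
  choose p hp hd using hex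
  have hsum : ∑ a, divergence φ (p a) (M.pbar s a) ≤ ENNReal.ofReal (M.kappa + x) := by
    refine (Finset.sum_le_sum fun a _ => (hd a).le).trans ?_
    rw [← ENNReal.ofReal_sum_of_nonneg fun a _ => ?_]
    · apply ENNReal.ofReal_le_ofReal
      rw [Finset.sum_add_distrib]
      simp only [Finset.sum_const, Finset.card_univ, Fintype.card_fin, nsmul_eq_mul]
      rw [mul_div_cancel₀ _ hA'.ne']
      linarith
    · have := hy a
      have : 0 ≤ ((M.projection v s a β).value φ).toReal := ENNReal.toReal_nonneg
      linarith
  refine M.bellman_le s hb hA (M.mix_mem_ambiguitySet s hφ hx0.le (fun a => (hp a).1) hsum)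
    fun a => ?_
  have h1 : ∑ i, p a i * M.payoff v s a i ≤ β := by
    refine (le_of_eq ?_).trans (hp a).2
    exact Finset.sum_congr rfl fun i _ => mul_comm _ _
  have h2 : ∑ i, M.pbar s a i * M.payoff v s a i ≤ M.Rbar :=
    sum_mul_le_of_mem_stdSimplex (M.pbar_mem s a) fun i => M.payoff_le_Rbar s hv a i
  have ht1 : M.kappa / (M.kappa + x) ≤ 1 := by
    rw [div_le_one (by positivity)]; linarith
  have h0 : 0 ≤ ∑ i, p a i * M.payoff v s a i :=
    Finset.sum_nonneg fun i _ => mul_nonneg ((hp a).1.1 i) (hb s a i)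
  calc _ = M.kappa / (M.kappa + x) * ∑ i, p a i * M.payoff v s a i
        + x / (M.kappa + x) * ∑ i, M.pbar s a i * M.payoff v s a i := by
        simp only [add_mul, Finset.sum_add_distrib, Finset.mul_sum, mul_assoc]
    _ ≤ 1 * β + x / (M.kappa + x) * M.Rbar :=
        add_le_add (mul_le_mul ht1 h1 h0 zero_le_one)
          (mul_le_mul_of_nonneg_left h2 (by positivity))
    _ ≤ β + ε / 2 := by linarith

end Minimax

end RobustMDP

/-! ### The program -/

/-!
Memory layout, for a projection program that writes only arrays below `N`.

Arrays of natural numbers (entry `0`): `N + 5` holds `S`, `N + 6` holds `A`, `N + 7` holds `A * S`,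
`N + 8` holds `S * A * S`; `N + 9`, `N + 10`, `N + 11` are the counters for states, actions and
entries of a row; `N + 12` is the index at which the current row starts, `N + 13` the index at which
the rows of the current state start.

Arrays of real numbers: `N + 5`, `N + 6`, `N + 7` are the copies of `p̄`, `r`, `v`, and `N + 8`
collects the result; entry `0` of `N + 9`, `N + 10`, `N + 11`, `N + 12` holds `λ`, `κ`, `ε`, `δ*`;
`N + 13` and `N + 14` are the ends of the bisection interval, `N + 15` and `N + 16` hold `b_aᵀ p̄_a`
and `min b_a`, `N + 17` the sum of the distances, `N + 18` the level `β`.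
-/

namespace RealRAM

/-- Entry `0` of the `k`-th array of natural numbers, used as a variable. -/
abbrev natVar (k : ℕ) : NExp := .get k (.lit 0)

/-- Entry `0` of the `k`-th array of real numbers, used as a variable. -/
abbrev realVar (k : ℕ) : RExp := .get k (.lit 0)

/-- Assignment to a natural variable. -/
abbrev assignNat (k : ℕ) (e : NExp) : Program := .setNat k (.lit 0) e

/-- Assignment to a real variable. -/
abbrev assignReal (k : ℕ) (e : RExp) : Program := .setReal k (.lit 0) e

/-- Loads the row of the tables that starts at `natVar (N + 12)` into the arrays `0` and `1`: the
nominal distribution `p̄` and the payoff `b = r + λ v`. The variables `N + 15` and `N + 16` receive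
`bᵀ p̄` and `min b`. -/
def loadRow (N : ℕ) : Program :=
  .seq (assignReal (N + 15) (.lit 0)) <|
  .seq (assignReal (N + 16)
    (.add (.get (N + 6) (natVar (N + 12))) (.mul (realVar (N + 9)) (realVar (N + 7))))) <|
  forLoop (N + 11) (N + 5) <|
    .seq (.setReal 0 (natVar (N + 11)) (.get (N + 5) (.add (natVar (N + 12)) (natVar (N + 11))))) <|
    .seq (.setReal 1 (natVar (N + 11)) (.add
      (.get (N + 6) (.add (natVar (N + 12)) (natVar (N + 11))))
      (.mul (realVar (N + 9)) (.get (N + 7) (natVar (N + 11)))))) <|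
    .seq (assignReal (N + 15) (.add (realVar (N + 15))
      (.mul (.get 1 (natVar (N + 11))) (.get 0 (natVar (N + 11)))))) <|
    .branch (.ltReal (.get 1 (natVar (N + 11))) (realVar (N + 16)))
      (assignReal (N + 16) (.get 1 (natVar (N + 11)))) .skip

/-- Computes the initial bounds `max_a min b_a` and `max_a b_aᵀ p̄_a` in the variables `N + 13` and
`N + 14`, for the state whose rows start at `natVar (N + 13)`. -/
def initBounds (N : ℕ) : Program :=
  .seq (assignReal (N + 13) (.lit 0)) <|
  .seq (assignReal (N + 14) (.lit 0)) <|
  .seq (assignNat (N + 12) (natVar (N + 13))) <|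
  forLoop (N + 10) (N + 6) <|
    .seq (loadRow N) <|
    .seq (.branch (.ltReal (realVar (N + 13)) (realVar (N + 16)))
      (assignReal (N + 13) (realVar (N + 16))) .skip) <|
    .seq (.branch (.ltReal (realVar (N + 14)) (realVar (N + 15)))
      (assignReal (N + 14) (realVar (N + 15))) .skip) <|
    assignNat (N + 12) (.add (natVar (N + 12)) (natVar (N + 5)))

/-- Calls `P` on the loaded row at the level `realVar (N + 18)` and adds the lower bound that it
returns to the variable `N + 17`. -/
def callProjection (P : Program) (N : ℕ) : Program :=
  .seq (assignNat 0 (natVar (N + 5))) <|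
  .seq (assignReal 2 (realVar (N + 18))) <|
  .seq (.setReal 2 (.lit 1) (realVar (N + 12))) <|
  .seq P <|
  assignReal (N + 17) (.add (realVar (N + 17)) (realVar 3))

/-- Sums up, in the variable `N + 17`, lower bounds of the optimal values of the projection
problems of all actions at the level `realVar (N + 18)`. The value is `0`, and `P` is not called,
if the level is at least `b_aᵀ p̄_a`. -/
def sumProjections (P : Program) (N : ℕ) : Program :=
  .seq (assignReal (N + 17) (.lit 0)) <|
  .seq (assignNat (N + 12) (natVar (N + 13))) <|
  forLoop (N + 10) (N + 6) <|
    .seq (loadRow N) <|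
    .seq (.branch (.ltReal (realVar (N + 18)) (realVar (N + 15))) (callProjection P N) .skip) <|
    assignNat (N + 12) (.add (natVar (N + 12)) (natVar (N + 5)))

/-- One step of the bisection of the interval between the variables `N + 13` and `N + 14`. -/
def bisectionStep (P : Program) (N : ℕ) : Program :=
  .seq (assignReal (N + 18) (.div (.add (realVar (N + 13)) (realVar (N + 14))) (.lit 2))) <|
  .seq (sumProjections P N) <|
  .branch (.ltReal (realVar (N + 10)) (realVar (N + 17)))
    (assignReal (N + 13) (realVar (N + 18))) (assignReal (N + 14) (realVar (N + 18)))

/-- The guard of the bisection: the interval is longer than `ε`. -/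
def bisectionGuard (N : ℕ) : Cond :=
  .ltReal (realVar (N + 11)) (.sub (realVar (N + 14)) (realVar (N + 13)))

/-- The update of one state, stored in array `N + 8`. -/
def stateUpdate (P : Program) (N : ℕ) : Program :=
  .seq (initBounds N) <|
  .seq (.loop (bisectionGuard N) (bisectionStep P N)) <|
  .seq (.setReal (N + 8) (natVar (N + 9))
    (.add (.div (.add (realVar (N + 13)) (realVar (N + 14))) (.lit 2))
      (.div (realVar (N + 11)) (.lit 4)))) <|
  assignNat (N + 13) (.add (natVar (N + 13)) (natVar (N + 7)))

/-- Copies the tables to arrays that the projection program does not write; the variable `N + 12`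
receives the maximal reward. -/
def copyTables (N : ℕ) : Program :=
  .seq (assignReal (N + 12) (.lit 0)) <|
  forLoop (N + 11) (N + 8) <|
    .seq (.setReal (N + 5) (natVar (N + 11)) (.get 0 (natVar (N + 11)))) <|
    .seq (.setReal (N + 6) (natVar (N + 11)) (.get 1 (natVar (N + 11)))) <|
    .branch (.ltReal (realVar (N + 12)) (.get 1 (natVar (N + 11))))
      (assignReal (N + 12) (.get 1 (natVar (N + 11)))) .skip

/-- Copies the value vector. -/
def copyValues (N : ℕ) : Program :=
  forLoop (N + 11) (N + 5) (.setReal (N + 7) (natVar (N + 11)) (.get 2 (natVar (N + 11))))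

/-- Computes `A * S` and `S * (A * S)` by repeated addition. -/
def computeSizes (N : ℕ) : Program :=
  .seq (assignNat (N + 7) (.lit 0)) <|
  .seq (forLoop (N + 11) (N + 6) (assignNat (N + 7) (.add (natVar (N + 7)) (natVar (N + 5))))) <|
  .seq (assignNat (N + 8) (.lit 0)) <|
  forLoop (N + 11) (N + 5) (assignNat (N + 8) (.add (natVar (N + 8)) (natVar (N + 7))))

/-- Computes the accuracy of the projections from the maximal reward. -/
def computeAccuracy (N : ℕ) : Program :=
  .seq (assignReal (N + 12)
    (.mul (.div (.lit 1) (.sub (.lit 1) (realVar (N + 9)))) (realVar (N + 12)))) <|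
  assignReal (N + 12) (.div (.mul (realVar (N + 11)) (realVar (N + 10)))
    (.add (.mul (.mul (.lit 2) (.cast (natVar (N + 6)))) (realVar (N + 12)))
      (.mul (.cast (natVar (N + 6))) (realVar (N + 11)))))

/-- Copies the input to arrays that the projection program does not write, and computes the
quantities that do not depend on the state. -/
def setup (N : ℕ) : Program :=
  .seq (assignNat (N + 5) (natVar 0)) <|
  .seq (assignNat (N + 6) (.get 0 (.lit 1))) <|
  .seq (assignReal (N + 9) (realVar 3)) <|
  .seq (assignReal (N + 10) (.get 3 (.lit 1))) <|
  .seq (assignReal (N + 11) (.get 3 (.lit 2))) <|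
  .seq (computeSizes N) <|
  .seq (copyTables N) <|
  .seq (copyValues N) <|
  computeAccuracy N

/-- Writes the result to the output array. -/
def copyOutput (N : ℕ) : Program :=
  forLoop (N + 11) (N + 5) (.setReal 4 (natVar (N + 11)) (.get (N + 8) (natVar (N + 11))))

/-- The robust Bellman update by bisection, for a projection program `P` that writes only arrays
with numbers below `N`. -/
def bellmanProgram (P : Program) (N : ℕ) : Program :=
  .seq (setup N) <|
  .seq (assignNat (N + 13) (.lit 0)) <|
  .seq (forLoop (N + 9) (N + 5) (stateUpdate P N)) <|
  copyOutput N

/-- The program writes only arrays with numbers below `N`. -/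
def Program.WritesBelow (P : Program) (N : ℕ) : Prop :=
  ∀ k, (P.WritesNat k ∨ P.WritesReal k) → k < N

lemma Program.WritesBelow.not_writesNat {P : Program} {N : ℕ} (h : P.WritesBelow N) (k : ℕ) :
    ¬ P.WritesNat (N + k) := fun hk => by have := h _ (.inl hk); omega

lemma Program.WritesBelow.not_writesReal {P : Program} {N : ℕ} (h : P.WritesBelow N) (k : ℕ) :
    ¬ P.WritesReal (N + k) := fun hk => by have := h _ (.inr hk); omega

/-! ### Correctness of the program -/

variable {S A : ℕ}

/-- The protected arrays hold the robust Markov decision process, the value vector, the accuracy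
`ε` and the accuracy of the projections. -/
structure Holds (N : ℕ) (M : RobustMDP S A) (v : Fin S → ℝ) (ε : ℝ) (σ : Store) : Prop where
  states : σ.nat (N + 5) 0 = S
  actions : σ.nat (N + 6) 0 = A
  stride : σ.nat (N + 7) 0 = A * S
  pbar : ∀ (s : Fin S) (a : Fin A) (s' : Fin S),
    σ.real (N + 5) (((s : ℕ) * A + a) * S + s') = M.pbar s a s'
  r : ∀ (s : Fin S) (a : Fin A) (s' : Fin S),
    σ.real (N + 6) (((s : ℕ) * A + a) * S + s') = M.r s a s'
  v : ∀ s : Fin S, σ.real (N + 7) s = v s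
  lam : σ.real (N + 9) 0 = M.lam
  kappa : σ.real (N + 10) 0 = M.kappa
  eps : σ.real (N + 11) 0 = ε
  delta : σ.real (N + 12) 0 = M.projectionAccuracy ε

variable {N : ℕ} {M : RobustMDP S A} {v : Fin S → ℝ} {ε : ℝ} {F : ℕ → ℝ → ℝ} {P : Program}
  {σ τ : Store}

lemma Holds.of_frame {c : Program} (h : Holds N M v ε σ) (hf : c.Frame σ τ)
    (hn : ∀ k, 5 ≤ k → k < 8 → ¬ c.WritesNat (N + k))
    (hr : ∀ k, 5 ≤ k → k < 13 → k ≠ 8 → ¬ c.WritesReal (N + k)) : Holds N M v ε τ where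
  states := by rw [hf.nat _ (hn 5 (by omega) (by omega)), h.states]
  actions := by rw [hf.nat _ (hn 6 (by omega) (by omega)), h.actions]
  stride := by rw [hf.nat _ (hn 7 (by omega) (by omega)), h.stride]
  pbar s a s' := by rw [hf.real _ (hr 5 (by omega) (by omega) (by omega)), h.pbar]
  r s a s' := by rw [hf.real _ (hr 6 (by omega) (by omega) (by omega)), h.r]
  v s := by rw [hf.real _ (hr 7 (by omega) (by omega) (by omega)), h.v]
  lam := by rw [hf.real _ (hr 9 (by omega) (by omega) (by omega)), h.lam]
  kappa := by rw [hf.real _ (hr 10 (by omega) (by omega) (by omega)), h.kappa]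
  eps := by rw [hf.real _ (hr 11 (by omega) (by omega) (by omega)), h.eps]
  delta := by rw [hf.real _ (hr 12 (by omega) (by omega) (by omega)), h.delta]

/-- The row of the state-action pair `(s, a)` is loaded. -/
structure RowLoaded (N : ℕ) (M : RobustMDP S A) (v : Fin S → ℝ) (s : Fin S) (a : Fin A)
    (σ : Store) : Prop where
  pbar : ∀ i : Fin S, σ.real 0 i = M.pbar s a i
  b : ∀ i : Fin S, σ.real 1 i = M.payoff v s a i
  expected : σ.real (N + 15) 0 = ∑ i, M.payoff v s a i * M.pbar s a i
  min_le : ∀ i, σ.real (N + 16) 0 ≤ M.payoff v s a i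
  min_eq : ∃ i, σ.real (N + 16) 0 = M.payoff v s a i

lemma runs_loadRow (hσ : Holds N M v ε σ) {s : Fin S} {a : Fin A}
    (hrow : σ.nat (N + 12) 0 = ((s : ℕ) * A + a) * S) :
    Runs F (loadRow N) σ (100 * S) (RowLoaded N M v s a) := by
  have hS : 0 < S := s.pos
  set p : ℕ → ℝ := fun i => σ.real (N + 5) (((s : ℕ) * A + a) * S + i) with hp
  set b : ℕ → ℝ := fun i => σ.real (N + 6) (((s : ℕ) * A + a) * S + i)
    + M.lam * σ.real (N + 7) i with hb
  have hpi : ∀ i : Fin S, p i = M.pbar s a i := fun i => hσ.pbar s a i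
  have hbi : ∀ i : Fin S, b i = M.payoff v s a i := fun i => by
    simp only [hb, RobustMDP.payoff, hσ.r, hσ.v]
  refine Runs.mono (Runs.setReal_seq (Runs.setReal_seq (Runs.forLoop (T := 56) (m := S)
    (Inv := fun k τ => (∀ i < k, τ.real 0 i = p i ∧ τ.real 1 i = b i) ∧
      τ.real (N + 15) 0 = ∑ i ∈ Finset.range k, b i * p i ∧
      (∀ i < k, τ.real (N + 16) 0 ≤ b i) ∧ ∃ i < S, τ.real (N + 16) 0 = b i)
    (by omega) ?_ ?_ ?_ ?_ ?_))) (T' := 100 * S) ?_ ?_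
  · simp [Program.WritesNat]
  · simp [Program.WritesNat]
  · simpa using hσ.states
  · refine ⟨by simp, by simp [Store.setReal_real, NExp.eval, RExp.eval], by simp, 0, hS, ?_⟩
    simp [Store.setReal_real, NExp.eval, RExp.eval, hb, hrow, hσ.lam]
  · rintro k hk τ ⟨h1, h2, h3, h4⟩ hik hf
    have e12 : τ.nat (N + 12) 0 = ((s : ℕ) * A + a) * S := by
      rw [hf.nat (N + 12) (by simp [Program.WritesNat])]; simpa using hrow
    have e5 : τ.real (N + 5) = σ.real (N + 5) := by
      rw [hf.real (N + 5) (by simp [Program.WritesReal])]; ext; simp [Store.setReal_real]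
    have e6 : τ.real (N + 6) = σ.real (N + 6) := by
      rw [hf.real (N + 6) (by simp [Program.WritesReal])]; ext; simp [Store.setReal_real]
    have e7 : τ.real (N + 7) = σ.real (N + 7) := by
      rw [hf.real (N + 7) (by simp [Program.WritesReal])]; ext; simp [Store.setReal_real]
    have e9 : τ.real (N + 9) 0 = M.lam := by
      rw [hf.real (N + 9) (by simp [Program.WritesReal])]; simpa [Store.setReal_real] using hσ.lam
    have epk : σ.real (N + 5) (((s : ℕ) * A + a) * S + k) = p k := rfl
    have ebk : σ.real (N + 6) (((s : ℕ) * A + a) * S + k) + M.lam * σ.real (N + 7) k = b k := rfl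
    have hrows : ∀ i ≤ k, (if i = k then p k else τ.real 0 i) = p i ∧
        (if i = k then b k else τ.real 1 i) = b i := by
      intro i hi
      split_ifs with h
      · simp [h]
      · exact h1 i (by omega)
    clear_value p b
    refine Runs.mono_time (Runs.setReal_seq (Runs.setReal_seq (Runs.setReal_seq
      (Runs.branch (T := 5) (fun ht => Runs.mono_time (Runs.setReal ?_) ?_)
        (fun ht => Runs.mono_time (Runs.skip ?_) ?_))))) (by simp [RExp.cost, NExp.cost, Cond.cost])
    · simp [Cond.Holds, Store.setReal_real, NExp.eval, RExp.eval, hik, e12, e5, e6, e7, e9, epk,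
        ebk] at ht
      simp [Store.setReal_real, NExp.eval, RExp.eval, hik, e12, e5, e6, e7, e9, epk, ebk]
      refine ⟨hrows, by rw [h2, Finset.sum_range_succ], fun i hi => ?_, k, hk, rfl⟩
      rcases hi.lt_or_eq with hi | rfl
      · exact ht.le.trans (h3 i hi)
      · exact le_rfl
    · simp [RExp.cost, NExp.cost]
    · simp [Cond.Holds, Store.setReal_real, NExp.eval, RExp.eval, hik, e12, e5, e6, e7, e9, epk,
        ebk] at ht
      simp [Store.setReal_real, NExp.eval, RExp.eval, hik, e12, e5, e6, e7, e9, epk, ebk]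
      refine ⟨hrows, by rw [h2, Finset.sum_range_succ], fun i hi => ?_, h4⟩
      rcases hi.lt_or_eq with hi | rfl
      · exact h3 i hi
      · exact ht
    · simp
  · simp [RExp.cost, NExp.cost]; omega
  · rintro τ ⟨h1, h2, h3, i, hi, h4⟩
    refine ⟨fun i => by rw [(h1 i i.2).1, hpi], fun i => by rw [(h1 i i.2).2, hbi], ?_,
      fun i => by rw [← hbi]; exact h3 i i.2, ⟨i, hi⟩, by rw [← hbi]; exact h4⟩
    rw [h2, Finset.sum_range]
    simp only [hbi, hpi]

end RealRAM

namespace ProjectionInstance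

/-- The real number `y` is a finite lower bound of the optimal value, with an error of at most
`δ`. -/
def IsLowerApprox (φ : ℝ≥0 → ℝ≥0∞) (I : ProjectionInstance) (δ y : ℝ) : Prop :=
  I.value φ ≠ ∞ ∧ y ≤ (I.value φ).toReal ∧ (I.value φ).toReal ≤ y + δ

end ProjectionInstance

namespace RealRAM

variable {S A N K : ℕ} {M : RobustMDP S A} {v : Fin S → ℝ} {ε : ℝ} {F : ℕ → ℝ → ℝ} {P : Program}
  {σ τ : Store} {φ : ℝ≥0 → ℝ≥0∞} {s : Fin S}

@[simp] lemma writesNat_loadRow (k : ℕ) : (loadRow N).WritesNat k ↔ k = N + 11 := by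
  simp [loadRow, Program.WritesNat]

@[simp] lemma writesReal_loadRow (k : ℕ) :
    (loadRow N).WritesReal k ↔ k = 0 ∨ k = 1 ∨ k = N + 15 ∨ k = N + 16 := by
  simp [loadRow, Program.WritesReal]; tauto

/-- The variable `k` is raised to the value of `e` if that is larger. -/
lemma runs_max (k : ℕ) (e : RExp) :
    Runs F (.branch (.ltReal (realVar k) e) (assignReal k e) .skip) σ (2 * e.cost + 6)
      (· = σ.setReal k 0 (max (σ.real k 0) (e.eval F σ))) := by
  refine Runs.mono_time (Runs.branch (T := e.cost + 2)
    (fun ht => (Runs.setReal ?_).mono_time ?_) fun ht => (Runs.skip ?_).mono_time ?_)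
    (by simp [Cond.cost, RExp.cost, NExp.cost]; omega)
  · simp only [Cond.Holds, RExp.eval, NExp.eval] at ht
    rw [max_eq_right ht.le]; rfl
  · simp [NExp.cost]; omega
  · simp only [Cond.Holds, RExp.eval, NExp.eval, not_lt] at ht
    rw [max_eq_left ht]; simp [Store.setReal]
  · omega

/-- The invariant of the bisection, apart from the length of the interval: the robust Bellman update
lies above the lower end and at most `ε / 2` above the upper end. The lower end is at least the
minimal payoff of every action, so that the projection problems at higher levels are feasible. -/
structure Bracket (N : ℕ) (φ : ℝ≥0 → ℝ≥0∞) (M : RobustMDP S A) (v : Fin S → ℝ) (ε : ℝ) (s : Fin S)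
    (σ : Store) : Prop where
  nonneg : 0 ≤ σ.real (N + 13) 0
  exists_payoff_le : ∀ a, ∃ i, M.payoff v s a i ≤ σ.real (N + 13) 0
  le_bellman : σ.real (N + 13) 0 ≤ M.bellman φ v s
  bellman_le : M.bellman φ v s ≤ σ.real (N + 14) 0 + ε / 2

lemma runs_initBounds (hφ : IsDivergenceFunction φ) (hb : ∀ s a s', 0 ≤ M.payoff v s a s')
    (hv : ∀ s, v s ≤ M.Rbar) (hA : 0 < A) (hε : 0 < ε) (hσ : Holds N M v ε σ)
    (hbase : σ.nat (N + 13) 0 = s * (A * S)) :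
    Runs F (initBounds N) σ (200 * (A * S)) (fun τ => Bracket N φ M v ε s τ ∧
      τ.real (N + 14) 0 - τ.real (N + 13) 0 ≤ M.Rbar) := by
  have hS : 0 < S := s.pos
  have h0 : 0 ≤ M.bellman φ v s := M.le_bellman s hb hφ hv fun p hp =>
    ⟨⟨0, hA⟩, RobustMDP.le_sum_mul_of_mem_stdSimplex (hp.1 _) fun i => hb s _ i⟩
  refine Runs.mono (Runs.setReal_seq (Runs.setReal_seq (Runs.setNat_seq (Runs.forLoop
    (T := 100 * S + 35) (m := A)
    (Inv := fun k τ => τ.nat (N + 12) 0 = (s * A + k) * S ∧ 0 ≤ τ.real (N + 13) 0 ∧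
      (∀ a : Fin A, a < k → ∃ i, M.payoff v s a i ≤ τ.real (N + 13) 0) ∧
      (∀ a : Fin A, a < k → ∑ i, M.payoff v s a i * M.pbar s a i ≤ τ.real (N + 14) 0) ∧
      τ.real (N + 13) 0 ≤ M.bellman φ v s ∧ τ.real (N + 14) 0 ≤ M.Rbar)
    (by omega) ?_ ?_ ?_ ?_ ?_)))) (T' := 200 * (A * S)) ?_ ?_
  · simp [Program.WritesNat]
  · simp [Program.WritesNat]
  · simpa [Store.setNat_nat, Store.setReal_real] using hσ.actions
  · simp [Store.setNat_nat, Store.setReal_real, NExp.eval, RExp.eval, hbase, h0, M.Rbar_nonneg]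
    ring
  · rintro k hk τ ⟨h1, h2, h3, h4, h5, h6⟩ hik hf
    have hτ : Holds N M v ε τ := by
      refine Holds.of_frame (c := initBounds N) hσ (Program.Frame.trans ?_ (hf.mono ?_ ?_))
        (by simp [initBounds, Program.WritesNat]; omega)
        (by simp [initBounds, Program.WritesReal]; omega)
      · exact (((Program.Frame.refl _ _).setReal (by simp [initBounds, Program.WritesReal])).setReal
          (by simp [initBounds, Program.WritesReal])).setNat
          (by simp [initBounds, Program.WritesNat])
      · simp [initBounds, Program.WritesNat]
      · simp [initBounds, Program.WritesReal]; tauto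
    refine Runs.mono_time (Runs.seq (runs_loadRow (a := ⟨k, hk⟩) hτ h1).frame fun ρ hρ =>
      Runs.seq (runs_max _ _) fun ρ₁ hρ₁ => Runs.seq (runs_max _ _) fun ρ₂ hρ₂ => Runs.setNat ?_)
      (by simp [RExp.cost, NExp.cost])
    obtain ⟨hρ, hρf⟩ := hρ
    subst hρ₂ hρ₁
    have e12 : ρ.nat (N + 12) 0 = (s * A + k) * S := by rw [hρf.nat _ (by simp), h1]
    have e5 : ρ.nat (N + 5) 0 = S := by rw [hρf.nat _ (by simp), hτ.states]
    have e13 : ρ.real (N + 13) 0 = τ.real (N + 13) 0 := by rw [hρf.real _ (by simp)]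
    have e14 : ρ.real (N + 14) 0 = τ.real (N + 14) 0 := by rw [hρf.real _ (by simp)]
    simp [Store.setNat_nat, Store.setReal_real, NExp.eval, RExp.eval, e12, e5, e13, e14]
    refine ⟨by ring, .inl h2, ?_, ?_, ⟨h5, ?_⟩, h6, ?_⟩
    · intro a ha
      rcases ha.lt_or_eq with ha | ha
      · obtain ⟨i, hi⟩ := h3 a ha
        exact ⟨i, .inl hi⟩
      · obtain ⟨i, hi⟩ := hρ.min_eq
        obtain rfl : a = ⟨k, hk⟩ := Fin.ext ha
        exact ⟨i, .inr hi.ge⟩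
    · intro a ha
      rcases ha.lt_or_eq with ha | ha
      · exact .inl (h4 a ha)
      · obtain rfl : a = ⟨k, hk⟩ := Fin.ext ha
        exact .inr hρ.expected.ge
    · exact M.le_bellman s hb hφ hv fun p hp =>
        ⟨⟨k, hk⟩, RobustMDP.le_sum_mul_of_mem_stdSimplex (hp.1 _) fun i => hρ.min_le i⟩
    · rw [hρ.expected]
      simp only [mul_comm (M.payoff _ _ _ _)]
      exact RobustMDP.sum_mul_le_of_mem_stdSimplex (M.pbar_mem s _) fun i =>
        M.payoff_le_Rbar s hv _ i
  · simp only [RExp.cost, NExp.cost]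
    nlinarith [Nat.mul_le_mul hA hS, Nat.mul_le_mul_left A hS]
  · rintro τ ⟨h1, h2, h3, h4, h5, h6⟩
    refine ⟨⟨h2, fun a => h3 a a.2, h5, ?_⟩, by linarith⟩
    have := M.bellman_le s hb hA (M.pbar_mem_ambiguitySet s hφ) (θ := τ.real (N + 14) 0) fun a => by
      simpa only [mul_comm (M.payoff _ _ _ _)] using h4 a a.2
    linarith

/-- The program `P` computes lower bounds of the optimal value of `I` to the accuracy `δ` within
`K` steps, in entry `0` of array `3`. -/
def LowerBounds (F : ℕ → ℝ → ℝ) (φ : ℝ≥0 → ℝ≥0∞) (P : Program) (K : ℕ) (I : ProjectionInstance)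
    (δ : ℝ) : Prop :=
  ∀ σ : Store, I.LoadedIn δ σ → Runs F P σ K (fun τ => I.IsLowerApprox φ δ (τ.real 3 0))

lemma runs_callProjection (hN : P.WritesBelow N) {a : Fin A} (hσ : Holds N M v ε σ)
    (hrow : RowLoaded N M v s a σ)
    (hP : LowerBounds F φ P K (M.projection v s a (σ.real (N + 18) 0)) (M.projectionAccuracy ε)) :
    Runs F (callProjection P N) σ (K + 30) (fun τ =>
      ∃ y, τ.real (N + 17) 0 = σ.real (N + 17) 0 + y ∧
      (M.projection v s a (σ.real (N + 18) 0)).IsLowerApprox φ (M.projectionAccuracy ε) y) := by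
  refine Runs.mono_time (Runs.setNat_seq (Runs.setReal_seq (Runs.setReal_seq
    (Runs.seq (hP _ ?_).frame fun τ hτ => Runs.setReal ?_)))) ?_
  · refine ⟨?_, fun i => ?_, fun i => ?_, ?_, ?_⟩
    · exact Eq.trans (by simp [Store.setNat_nat, NExp.eval]) hσ.states
    · exact Eq.trans (by simp [Store.setReal_real]) (hrow.pbar i)
    · exact Eq.trans (by simp [Store.setReal_real]) (hrow.b i)
    · simp [Store.setReal_real, NExp.eval, RExp.eval]; rfl
    · simpa [Store.setReal_real, NExp.eval, RExp.eval] using hσ.delta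
  · refine ⟨τ.real 3 0, ?_, hτ.1⟩
    simp [Store.setReal_real, NExp.eval, RExp.eval, hτ.2.real _ (hN.not_writesReal _)]
  · simp only [RExp.cost, NExp.cost]; omega

lemma runs_sumProjections (hφ : IsDivergenceFunction φ) (hN : P.WritesBelow N) (hA : 0 < A)
    (hε : 0 < ε) (hσ : Holds N M v ε σ) (hbase : σ.nat (N + 13) 0 = s * (A * S)) {β : ℝ}
    (hβ : σ.real (N + 18) 0 = β)
    (hP : ∀ a, β < ∑ i, M.payoff v s a i * M.pbar s a i →
      LowerBounds F φ P K (M.projection v s a β) (M.projectionAccuracy ε)) :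
    Runs F (sumProjections P N) σ (200 * (A * (S + K))) (fun τ => ∃ y : Fin A → ℝ,
      τ.real (N + 17) 0 = ∑ a, y a ∧
      ∀ a, (M.projection v s a β).IsLowerApprox φ (M.projectionAccuracy ε) (y a)) := by
  have hS : 0 < S := s.pos
  refine Runs.mono (Runs.setReal_seq (Runs.setNat_seq (Runs.forLoop
    (T := 100 * S + K + 50) (m := A)
    (Inv := fun k τ => τ.nat (N + 12) 0 = (s * A + k) * S ∧ ∃ y : ℕ → ℝ,
      τ.real (N + 17) 0 = ∑ a ∈ Finset.range k, y a ∧ ∀ a : Fin A, a < k →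
        (M.projection v s a β).IsLowerApprox φ (M.projectionAccuracy ε) (y a))
    (by omega) ?_ ?_ ?_ ?_ ?_))) (T' := 200 * (A * (S + K))) ?_ ?_
  · simp [Program.WritesNat, callProjection, hN.not_writesNat]
  · simp [Program.WritesNat, callProjection, hN.not_writesNat]
  · simpa [Store.setNat_nat, Store.setReal_real] using hσ.actions
  · simp [Store.setNat_nat, Store.setReal_real, NExp.eval, RExp.eval, hbase]
    ring
  · rintro k hk τ ⟨h1, y, h2, h3⟩ hik hf
    have hfr : (sumProjections P N).Frame σ τ := by
      refine Program.Frame.trans ?_ (hf.mono ?_ ?_)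
      · exact ((Program.Frame.refl _ _).setReal
          (by simp [sumProjections, Program.WritesReal])).setNat
          (by simp [sumProjections, Program.WritesNat])
      · simp [sumProjections, Program.WritesNat]; tauto
      · simp [sumProjections, Program.WritesReal]; tauto
    have hτ : Holds N M v ε τ := by
      refine Holds.of_frame hσ hfr ?_ ?_
      · simp [sumProjections, callProjection, Program.WritesNat, hN.not_writesNat]; omega
      · simp [sumProjections, callProjection, Program.WritesReal, hN.not_writesReal]; omega
    have e18 : τ.real (N + 18) 0 = β := by
      rw [hfr.real _ (by simp [sumProjections, callProjection, Program.WritesReal,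
        hN.not_writesReal]), hβ]
    refine Runs.mono_time (Runs.seq (runs_loadRow (a := ⟨k, hk⟩) hτ h1).frame fun ρ hρ =>
      Runs.seq (T := K + 40) (Post := fun τ' => (∃ z, τ'.real (N + 17) 0 = τ.real (N + 17) 0 + z ∧
        (M.projection v s ⟨k, hk⟩ β).IsLowerApprox φ (M.projectionAccuracy ε) z) ∧
          τ'.nat (N + 12) 0 = τ.nat (N + 12) 0 ∧ τ'.nat (N + 5) 0 = τ.nat (N + 5) 0) ?_
        fun ρ₁ hρ₁ => Runs.setNat ?_) ?_
    · obtain ⟨hρ, hρf⟩ := hρ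
      have hρh : Holds N M v ε ρ := hτ.of_frame hρf (by simp; omega) (by simp; omega)
      have e12 : ρ.nat (N + 12) 0 = τ.nat (N + 12) 0 := by rw [hρf.nat _ (by simp)]
      have e5 : ρ.nat (N + 5) 0 = τ.nat (N + 5) 0 := by rw [hρf.nat _ (by simp)]
      have e17 : ρ.real (N + 17) 0 = τ.real (N + 17) 0 := by rw [hρf.real _ (by simp)]
      have e18' : ρ.real (N + 18) 0 = β := by rw [hρf.real _ (by simp), e18]
      refine Runs.mono_time (Runs.branch (T := K + 30) (fun ht => ?_) fun ht => ?_) ?_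
      · simp only [Cond.Holds, RExp.eval, NExp.eval, e18', hρ.expected] at ht
        refine (runs_callProjection hN hρh hρ (e18' ▸ hP _ ht)).frame.mono le_rfl ?_
        rintro τ' ⟨⟨z, hz, hz'⟩, hf'⟩
        refine ⟨⟨z, by rw [hz, e17], e18' ▸ hz'⟩, ?_, ?_⟩
        · rw [hf'.nat _ (by simp [callProjection, Program.WritesNat, hN.not_writesNat]), e12]
        · rw [hf'.nat _ (by simp [callProjection, Program.WritesNat, hN.not_writesNat]), e5]
      · -- The nominal distribution is feasible at this level, so the distance is `0`.
        simp only [Cond.Holds, RExp.eval, NExp.eval, e18', hρ.expected, not_lt] at ht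
        refine Runs.mono_time (Runs.skip ⟨⟨0, by simp [e17], ?_⟩, e12, e5⟩) (by omega)
        have := M.projectionAccuracy_pos hA hε
        simp [ProjectionInstance.IsLowerApprox, M.value_projection_eq_zero s hφ ht, this.le]
      · simp only [Cond.cost, RExp.cost, NExp.cost]; omega
    · obtain ⟨⟨z, hz, hz'⟩, e12, e5⟩ := hρ₁
      simp only [Store.setNat_nat, Store.setNat_real, NExp.eval, e12, e5, h1, hτ.states]
      refine ⟨by simp; ring, fun a => if a = k then z else y a, ?_, fun a ha => ?_⟩
      · rw [hz, h2, Finset.sum_range_succ, if_pos rfl]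
        congr 1
        exact Finset.sum_congr rfl fun a ha => by rw [if_neg (Finset.mem_range.1 ha).ne]
      · rcases (Nat.lt_succ_iff.1 ha).lt_or_eq with ha | ha
        · simpa [ha.ne] using h3 a ha
        · obtain rfl : a = ⟨k, hk⟩ := Fin.ext ha
          simpa using hz'
    · simp [NExp.cost]; omega
  · simp only [RExp.cost, NExp.cost]
    nlinarith [Nat.mul_le_mul hA hS, Nat.mul_le_mul_left A hS, Nat.zero_le (A * K)]
  · rintro τ ⟨-, y, h1, h2⟩
    exact ⟨fun a => y a, by rw [h1, Finset.sum_range], fun a => h2 a a.2⟩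

/-- A step halves the bisection interval. -/
lemma runs_bisectionStep (hφ : IsDivergenceFunction φ) (hb : ∀ s a s', 0 ≤ M.payoff v s a s')
    (hv : ∀ s, v s ≤ M.Rbar) (hN : P.WritesBelow N) (hA : 0 < A)
    (hε : 0 < ε) (hσ : Holds N M v ε σ) (hbase : σ.nat (N + 13) 0 = s * (A * S))
    (hP : ∀ a β, (∃ i, M.payoff v s a i + ε / 2 ≤ β) →
      β < ∑ i, M.payoff v s a i * M.pbar s a i →
      LowerBounds F φ P K (M.projection v s a β) (M.projectionAccuracy ε))
    (hbr : Bracket N φ M v ε s σ) (hg : (bisectionGuard N).Holds F σ) :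
    Runs F (bisectionStep P N) σ (250 * (A * (S + K))) (fun τ => Bracket N φ M v ε s τ ∧
      τ.real (N + 14) 0 - τ.real (N + 13) 0 ≤ (σ.real (N + 14) 0 - σ.real (N + 13) 0) / 2) := by
  have hS : 0 < S := s.pos
  simp only [bisectionGuard, Cond.Holds, RExp.eval, NExp.eval, hσ.eps] at hg
  set lo := σ.real (N + 13) 0 with hlo
  set hi := σ.real (N + 14) 0 with hhi
  set β := (lo + hi) / 2 with hβ
  -- The interval is longer than `ε`, so `β` exceeds every `min b_a` by at least `ε / 2`.
  have hβlo : lo + ε / 2 ≤ β := by linarith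
  have hm := hbr.exists_payoff_le
  refine Runs.mono_time (Runs.setReal_seq (Runs.seq (runs_sumProjections (β := β) (K := K) (s := s)
    hφ hN hA hε (M := M) (v := v) ?_ ?_ ?_ ?_).frame fun τ hτ => Runs.branch (T := 10)
      (fun ht => (Runs.setReal ?_).mono_time ?_) fun ht => (Runs.setReal ?_).mono_time ?_)) ?_
  · refine hσ.of_frame (c := bisectionStep P N) ?_ ?_ ?_
    · exact (Program.Frame.refl _ _).setReal (by simp [bisectionStep, Program.WritesReal])
    · simp [bisectionStep, sumProjections, callProjection, Program.WritesNat, hN.not_writesNat]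
      omega
    · simp [bisectionStep, sumProjections, callProjection, Program.WritesReal, hN.not_writesReal]
      omega
  · simpa using hbase
  · simp [Store.setReal_real, NExp.eval, RExp.eval, hβ, hlo, hhi]
  · intro a ha
    obtain ⟨i, hi⟩ := hm a
    exact hP a β ⟨i, by linarith⟩ ha
  all_goals try (simp [RExp.cost, NExp.cost]; done)
  · obtain ⟨⟨y, hy, hy'⟩, hf⟩ := hτ
    have e : ∀ k, 9 < k → k ≠ 15 → k ≠ 16 → k ≠ 17 → k ≠ 18 → τ.real (N + k) = σ.real (N + k) := by
      intro k h0 h1 h2 h3 h4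
      rw [hf.real]
      · ext; simp [Store.setReal_real, h4]
      · simp [sumProjections, callProjection, Program.WritesReal, hN.not_writesReal]; omega
    have e18 : τ.real (N + 18) 0 = β := by
      rw [hf.real]
      · simp [Store.setReal_real, NExp.eval, RExp.eval, hβ, hlo, hhi]
      · simp [sumProjections, callProjection, Program.WritesReal, hN.not_writesReal]
    simp only [Cond.Holds, RExp.eval, NExp.eval, hy] at ht
    have hle := M.le_bellman_of_lt_sum_value s hb hφ hv (fun a => (hy' a).1) (fun a => (hy' a).2.1)
      (by simpa [e 10, hσ.kappa] using ht)
    refine ⟨⟨?_, fun a => ?_, ?_, ?_⟩, ?_⟩ <;>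
      simp [Store.setReal_real, RExp.eval, NExp.eval, e18, e 14, ← hhi]
    · linarith [hbr.nonneg]
    · obtain ⟨i, hi⟩ := hm a
      exact ⟨i, by linarith⟩
    · exact hle
    · exact hbr.bellman_le
    · linarith
  · obtain ⟨⟨y, hy, hy'⟩, hf⟩ := hτ
    have e : ∀ k, 9 < k → k ≠ 15 → k ≠ 16 → k ≠ 17 → k ≠ 18 → τ.real (N + k) = σ.real (N + k) := by
      intro k h0 h1 h2 h3 h4
      rw [hf.real]
      · ext; simp [Store.setReal_real, h4]
      · simp [sumProjections, callProjection, Program.WritesReal, hN.not_writesReal]; omega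
    have e18 : τ.real (N + 18) 0 = β := by
      rw [hf.real]
      · simp [Store.setReal_real, NExp.eval, RExp.eval, hβ, hlo, hhi]
      · simp [sumProjections, callProjection, Program.WritesReal, hN.not_writesReal]
    have hle := M.bellman_le_of_sum_value_le s hb hφ hA hv hε (fun a => (hy' a).1)
      (fun a => (hy' a).2.2)
      (by simpa [Cond.Holds, RExp.eval, NExp.eval, hy, e 10, hσ.kappa] using ht)
    refine ⟨⟨?_, fun a => ?_, ?_, ?_⟩, ?_⟩ <;>
      simp [Store.setReal_real, RExp.eval, NExp.eval, e18, e 13, ← hlo]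
    · exact hbr.nonneg
    · exact hm a
    · exact hbr.le_bellman
    · exact hle
    · linarith
  · have h1 : 1 ≤ A * (S + K) := Nat.mul_pos hA (by omega)
    simp only [RExp.cost, NExp.cost, Cond.cost]; omega

end RealRAM

namespace RealRAM

variable {S A N K J : ℕ} {M : RobustMDP S A} {v : Fin S → ℝ} {ε : ℝ} {F : ℕ → ℝ → ℝ} {P : Program}
  {σ τ : Store} {φ : ℝ≥0 → ℝ≥0∞} {s : Fin S}

/-- `J` halvings suffice, since the initial interval has length at most `R̄`. -/
lemma runs_stateUpdate (hφ : IsDivergenceFunction φ) (hb : ∀ s a s', 0 ≤ M.payoff v s a s')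
    (hv : ∀ s, v s ≤ M.Rbar) (hN : P.WritesBelow N) (hA : 0 < A)
    (hε : 0 < ε) (hσ : Holds N M v ε σ) (hbase : σ.nat (N + 13) 0 = s * (A * S))
    (hs : σ.nat (N + 9) 0 = s)
    (hP : ∀ a β, (∃ i, M.payoff v s a i + ε / 2 ≤ β) →
      β < ∑ i, M.payoff v s a i * M.pbar s a i →
      LowerBounds F φ P K (M.projection v s a β) (M.projectionAccuracy ε))
    (hJ : M.Rbar ≤ ε * 2 ^ J) :
    Runs F (stateUpdate P N) σ (300 * (A * (S + K)) * (J + 1)) (fun τ =>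
      |τ.real (N + 8) s - M.bellman φ v s| ≤ ε ∧
      (∀ i ≠ (s : ℕ), τ.real (N + 8) i = σ.real (N + 8) i) ∧
      τ.nat (N + 13) 0 = (s + 1) * (A * S)) := by
  have hS : 0 < S := s.pos
  have hAS : 0 < A * S := Nat.mul_pos hA hS
  refine Runs.mono_time (Runs.seq (runs_initBounds hφ hb hv hA hε hσ hbase).frame fun τ hτ =>
    Runs.seq (Runs.loop (T := 250 * (A * (S + K))) (k := J) (Inv := fun j τ =>
      Bracket N φ M v ε s τ ∧ τ.real (N + 14) 0 - τ.real (N + 13) 0 ≤ ε * 2 ^ j ∧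
        Holds N M v ε τ) ?_ ?_ ?_).frame fun ρ hρ => Runs.setReal_seq (Runs.setNat ?_)) ?_
  · rintro τ ⟨-, h1, h2⟩
    simp only [bisectionGuard, Cond.Holds, RExp.eval, NExp.eval, h2.eps, not_lt]
    linarith
  · rintro j ρ ⟨h1, h2, h3⟩ hg hf
    have hbase' : ρ.nat (N + 13) 0 = s * (A * S) := by
      rw [hf.nat _ (by simp [bisectionStep, sumProjections, callProjection, Program.WritesNat,
        hN.not_writesNat]), hτ.2.nat _ (by simp [initBounds, Program.WritesNat]), hbase]
    refine (runs_bisectionStep hφ hb hv hN hA hε h3 hbase' hP h1 hg).frame.mono le_rfl ?_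
    rintro υ ⟨⟨h4, h5⟩, h6⟩
    refine ⟨h4, ?_, h3.of_frame h6 ?_ ?_⟩
    · rw [pow_succ] at h2; linarith
    · simp [bisectionStep, sumProjections, callProjection, Program.WritesNat, hN.not_writesNat]
      omega
    · simp [bisectionStep, sumProjections, callProjection, Program.WritesReal, hN.not_writesReal]
      omega
  · exact ⟨hτ.1.1, hτ.1.2.trans hJ, hσ.of_frame hτ.2
      (by simp [initBounds, Program.WritesNat]; omega)
      (by simp [initBounds, Program.WritesReal]; omega)⟩
  · obtain ⟨⟨⟨j, h1, -, h3⟩, hg⟩, hf⟩ := hρ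
    have e9 : ρ.nat (N + 9) 0 = s := by
      rw [hf.nat _ (by simp [bisectionStep, sumProjections, callProjection, Program.WritesNat,
        hN.not_writesNat]), hτ.2.nat _ (by simp [initBounds, Program.WritesNat]), hs]
    have e13 : ρ.nat (N + 13) 0 = s * (A * S) := by
      rw [hf.nat _ (by simp [bisectionStep, sumProjections, callProjection, Program.WritesNat,
        hN.not_writesNat]), hτ.2.nat _ (by simp [initBounds, Program.WritesNat]), hbase]
    have e8 : ρ.real (N + 8) = σ.real (N + 8) := by
      rw [hf.real _ (by simp [bisectionStep, sumProjections, callProjection, Program.WritesReal,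
        hN.not_writesReal]), hτ.2.real _ (by simp [initBounds, Program.WritesReal])]
    simp only [bisectionGuard, Cond.Holds, RExp.eval, NExp.eval, h3.eps, not_lt] at hg
    have h5 := h1.le_bellman
    have h6 := h1.bellman_le
    refine ⟨?_, fun i hi => ?_, ?_⟩
    · simp [Store.setReal_real, RExp.eval, NExp.eval, e9, h3.eps]
      -- The value lies in `[lo, hi + ε / 2]`, of length at most `3 ε / 2`;
      -- the result is the midpoint.
      rw [abs_le]
      constructor <;> linarith
    · simp [Store.setReal_real, NExp.eval, e9, hi, e8]
    · simp [Store.setNat_nat, NExp.eval, e13, h3.stride]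
      ring
  · simp only [bisectionGuard, RExp.cost, NExp.cost, Cond.cost]
    have h1 : 1 ≤ A * (S + K) := Nat.mul_pos hA (by omega)
    have h2 : A * S ≤ A * (S + K) := Nat.mul_le_mul_left A (by omega)
    have h3 : J ≤ A * (S + K) * J := Nat.le_mul_of_pos_left _ h1
    nlinarith

/-- The tables of shape `S × A × S` occupy the first `S * A * S` entries. -/
lemma rowIndex_lt (s : Fin S) (a : Fin A) (s' : Fin S) :
    ((s : ℕ) * A + a) * S + s' < S * (A * S) := by
  have h1 : (s : ℕ) * A + a + 1 ≤ S * A := by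
    have := Nat.mul_le_mul_right A (Nat.succ_le_of_lt s.2)
    have := a.2
    rw [Nat.succ_mul] at *
    omega
  have h2 := Nat.mul_le_mul_right S h1
  have := s'.2
  rw [Nat.add_one_mul, mul_assoc S] at h2
  omega

lemma runs_copyTables (hA : 0 < A) (hS : 0 < S) (hT : σ.nat (N + 8) 0 = S * (A * S))
    (hr : ∀ (s : Fin S) (a : Fin A) (s' : Fin S),
      σ.real 1 (((s : ℕ) * A + a) * S + s') = M.r s a s') :
    Runs F (copyTables N) σ (60 * (S * (A * S))) (fun τ =>
      (∀ i < S * (A * S), τ.real (N + 5) i = σ.real 0 i ∧ τ.real (N + 6) i = σ.real 1 i) ∧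
      τ.real (N + 12) 0 = ⨆ x : Fin S × Fin A × Fin S, M.r x.1 x.2.1 x.2.2) := by
  -- Each of the first `S * A * S` entries belongs to the table, so no other
  -- number enters the maximum.
  have hidx : ∀ i < S * (A * S), ∃ (s : Fin S) (a : Fin A) (s' : Fin S),
      i = ((s : ℕ) * A + a) * S + s' := by
    intro i hi
    have h1 : i / S < S * A := Nat.div_lt_of_lt_mul (by nlinarith)
    refine ⟨⟨i / S / A, Nat.div_lt_of_lt_mul (by nlinarith)⟩, ⟨i / S % A, Nat.mod_lt _ hA⟩,
      ⟨i % S, Nat.mod_lt _ hS⟩, ?_⟩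
    simp only [Nat.div_add_mod']
  set R := ⨆ x : Fin S × Fin A × Fin S, M.r x.1 x.2.1 x.2.2 with hR
  have hR0 : 0 ≤ R := Real.iSup_nonneg fun _ => M.r_nonneg _ _ _
  refine Runs.mono (Runs.setReal_seq (Runs.forLoop (T := 35) (m := S * (A * S))
    (Inv := fun k τ => τ.real 0 = σ.real 0 ∧ τ.real 1 = σ.real 1 ∧
      (∀ i < k, τ.real (N + 5) i = σ.real 0 i ∧ τ.real (N + 6) i = σ.real 1 i) ∧
      0 ≤ τ.real (N + 12) 0 ∧ (∀ i < k, σ.real 1 i ≤ τ.real (N + 12) 0) ∧ τ.real (N + 12) 0 ≤ R)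
    (by omega) ?_ ?_ ?_ ?_ ?_)) (T' := 60 * (S * (A * S))) ?_ ?_
  · simp [Program.WritesNat]
  · simp [Program.WritesNat]
  · simpa using hT
  · refine ⟨?_, ?_, by simp, ?_, by simp, ?_⟩
    · ext; simp [Store.setReal_real]
    · ext; simp [Store.setReal_real]
    · simp [Store.setReal_real, RExp.eval, NExp.eval]
    · simpa [Store.setReal_real, RExp.eval, NExp.eval] using hR0
  · rintro k hk τ ⟨h0, h1, h2, h3, h4, h5⟩ hik hf
    refine Runs.mono (Runs.setReal_seq (Runs.setReal_seq (runs_max _ _)))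
      (by simp [RExp.cost, NExp.cost]) ?_
    rintro ρ rfl
    refine ⟨?_, ?_, ?_, ?_, ?_, ?_⟩
    · ext; simp [Store.setReal_real, h0]
    · ext; simp [Store.setReal_real, h1]
    · intro i hi
      simp only [Store.setNat_real, Store.setReal_real, Store.setReal_nat, RExp.eval,
        NExp.eval, hik, h0, h1]
      rcases (Nat.lt_succ_iff.1 hi).lt_or_eq with hi | rfl
      · simpa [hi.ne] using h2 i hi
      · simp
    · simp [Store.setReal_real, RExp.eval, NExp.eval, h3]
    · intro i hi
      simp [Store.setReal_real, RExp.eval, NExp.eval, hik, h1]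
      rcases (Nat.lt_succ_iff.1 hi).lt_or_eq with hi | rfl
      · exact .inl (h4 i hi)
      · exact .inr le_rfl
    · simp [Store.setReal_real, RExp.eval, NExp.eval, hik, h1, h5]
      obtain ⟨s, a, s', rfl⟩ := hidx k hk
      rw [hr]
      exact M.reward_le s a s'
  · have : 0 < S * (A * S) := by positivity
    simp only [RExp.cost, NExp.cost]; omega
  · rintro τ ⟨-, -, h2, -, h4, h5⟩
    have : Nonempty (Fin S × Fin A × Fin S) := ⟨⟨0, hS⟩, ⟨0, hA⟩, ⟨0, hS⟩⟩
    exact ⟨h2, h5.antisymm (ciSup_le fun x => hr x.1 x.2.1 x.2.2 ▸ h4 _ (rowIndex_lt _ _ _))⟩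

lemma runs_copyValues (hS : 0 < S) (hσ : σ.nat (N + 5) 0 = S) :
    Runs F (copyValues N) σ (30 * S) (fun τ => ∀ i < S, τ.real (N + 7) i = σ.real 2 i) := by
  refine Runs.mono (Runs.forLoop (T := 8) (m := S)
    (Inv := fun k τ => τ.real 2 = σ.real 2 ∧ ∀ i < k, τ.real (N + 7) i = σ.real 2 i)
    (by omega) ?_ ?_ hσ ?_ ?_) (T' := 30 * S) (by omega) fun _ h => h.2
  · simp [Program.WritesNat]
  · simp [Program.WritesNat]
  · simp
  · rintro k hk τ ⟨h0, h1⟩ hik -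
    refine Runs.mono_time (Runs.setReal ⟨?_, fun i hi => ?_⟩) (by simp [RExp.cost, NExp.cost])
    · ext; simp [Store.setReal_real, h0]
    · simp only [Store.setNat_real, Store.setReal_real, RExp.eval, NExp.eval, hik, h0]
      rcases (Nat.lt_succ_iff.1 hi).lt_or_eq with hi | rfl
      · simpa [hi.ne] using h1 i hi
      · simp

lemma runs_copyOutput (hS : 0 < S) (hσ : σ.nat (N + 5) 0 = S) :
    Runs F (copyOutput N) σ (30 * S) (fun τ => ∀ i < S, τ.real 4 i = σ.real (N + 8) i) := by
  refine Runs.mono (Runs.forLoop (T := 8) (m := S)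
    (Inv := fun k τ => τ.real (N + 8) = σ.real (N + 8) ∧ ∀ i < k, τ.real 4 i = σ.real (N + 8) i)
    (by omega) ?_ ?_ hσ ?_ ?_) (T' := 30 * S) (by omega) fun _ h => h.2
  · simp [Program.WritesNat]
  · simp [Program.WritesNat]
  · simp
  · rintro k hk τ ⟨h0, h1⟩ hik -
    refine Runs.mono_time (Runs.setReal ⟨?_, fun i hi => ?_⟩) (by simp [RExp.cost, NExp.cost])
    · ext; simp [Store.setReal_real, h0]
    · simp only [Store.setNat_real, Store.setReal_real, RExp.eval, NExp.eval, hik, h0]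
      rcases (Nat.lt_succ_iff.1 hi).lt_or_eq with hi | rfl
      · simpa [hi.ne] using h1 i hi
      · simp

/-- Multiplication by repeated addition. -/
lemma runs_accumulate {i b j k m x : ℕ} (hib : i ≠ b) (hij : i ≠ j) (hjb : j ≠ b) (hik : i ≠ k)
    (hjk : j ≠ k) (hb : σ.nat b 0 = m) (hk : σ.nat k 0 = x) (hj : σ.nat j 0 = 0) :
    Runs F (forLoop i b (assignNat j (.add (natVar j) (natVar k)))) σ (m * 18 + 8)
      (fun τ => τ.nat j 0 = m * x) := by
  refine Runs.forLoop (T := 7) (Inv := fun n τ => τ.nat j 0 = n * x) hib ?_ ?_ hb ?_ ?_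
  · simpa [Program.WritesNat] using hij
  · simpa [Program.WritesNat] using hjb.symm
  · simp [Store.setNat_nat, hij.symm, hj]
  · rintro n hn τ h1 - hf
    have h2 : τ.nat k 0 = x := by
      rw [hf.nat k (by simp [Program.WritesNat, hik.symm, hjk.symm]), hk]
    refine Runs.mono_time (Runs.setNat ?_) (by simp [NExp.cost])
    simp [Store.setNat_nat, NExp.eval, hij.symm, h1, h2]
    ring

lemma runs_computeSizes (hA : 0 < A) (hS : 0 < S) (h5 : σ.nat (N + 5) 0 = S)
    (h6 : σ.nat (N + 6) 0 = A) :
    Runs F (computeSizes N) σ (100 * (S * (A * S))) (fun τ =>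
      τ.nat (N + 7) 0 = A * S ∧ τ.nat (N + 8) 0 = S * (A * S)) := by
  refine Runs.mono_time (Runs.setNat_seq (Runs.seq (runs_accumulate (m := A) (x := S)
    (by omega) (by omega) (by omega) (by omega) (by omega) ?_ ?_ ?_).frame fun τ hτ =>
      Runs.setNat_seq ((runs_accumulate (m := S) (x := A * S)
        (by omega) (by omega) (by omega) (by omega) (by omega) ?_ ?_ ?_).frame.mono le_rfl ?_))) ?_
  · simpa [Store.setNat_nat] using h6
  · simpa [Store.setNat_nat] using h5
  · simp [Store.setNat_nat, NExp.eval]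
  · simp [Store.setNat_nat]
    rw [hτ.2.nat _ (by simp [Program.WritesNat])]
    simpa [Store.setNat_nat] using h5
  · simpa [Store.setNat_nat] using hτ.1
  · simp [Store.setNat_nat, NExp.eval]
  · rintro ρ ⟨h7, hf⟩
    refine ⟨?_, h7⟩
    rw [hf.nat _ (by simp [Program.WritesNat])]
    simpa [Store.setNat_nat] using hτ.1
  · simp only [NExp.cost]
    have h1 : 1 ≤ S * (A * S) := Nat.mul_pos hS (Nat.mul_pos hA hS)
    have h2 : A ≤ S * (A * S) := by
      calc A ≤ A * S := Nat.le_mul_of_pos_right _ hS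
        _ ≤ _ := Nat.le_mul_of_pos_left _ hS
    have h3 : S ≤ S * (A * S) := Nat.le_mul_of_pos_right _ (Nat.mul_pos hA hS)
    omega

lemma runs_computeAccuracy {x y z w : ℝ} {m : ℕ} (h9 : σ.real (N + 9) 0 = x)
    (h10 : σ.real (N + 10) 0 = y) (h11 : σ.real (N + 11) 0 = z) (h12 : σ.real (N + 12) 0 = w)
    (h6 : σ.nat (N + 6) 0 = m) :
    Runs F (computeAccuracy N) σ 50 (fun τ =>
      τ.real (N + 12) 0 = z * y / (2 * m * ((1 - x)⁻¹ * w) + m * z)) := by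
  refine Runs.mono_time (Runs.setReal_seq (Runs.setReal ?_)) (by simp [RExp.cost, NExp.cost])
  simp [Store.setReal_real, RExp.eval, NExp.eval, h9, h10, h11, h12, h6]

lemma runs_setup (hA : 0 < A) (hS : 0 < S) (hσ : M.LoadedIn v ε σ) :
    Runs F (setup N) σ (300 * (S * (A * S))) (Holds N M v ε) := by
  obtain ⟨hS', hA', hp, hr, hv, hl, hk, he⟩ := hσ
  refine Runs.mono_time (Runs.setNat_seq (Runs.setNat_seq (Runs.setReal_seq (Runs.setReal_seq
    (Runs.setReal_seq (T := 100 * (S * (A * S)) + (60 * (S * (A * S)) + (30 * S + 50))) ?_))))) ?_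
  · set σ₁ := Store.setReal _ _ _ _ with hσ₁
    have a5 : σ₁.nat (N + 5) 0 = S := by simp [hσ₁, Store.setNat_nat, NExp.eval, hS']
    have a6 : σ₁.nat (N + 6) 0 = A := by simp [hσ₁, Store.setNat_nat, NExp.eval, hA']
    have b9 : σ₁.real (N + 9) 0 = M.lam := by
      simp [hσ₁, Store.setReal_real, NExp.eval, RExp.eval, hl]
    have b10 : σ₁.real (N + 10) 0 = M.kappa := by
      simp [hσ₁, Store.setReal_real, NExp.eval, RExp.eval, hk]
    have b11 : σ₁.real (N + 11) 0 = ε := by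
      simp [hσ₁, Store.setReal_real, NExp.eval, RExp.eval, he]
    have b0 : ∀ i, σ₁.real 0 i = σ.real 0 i := fun i => by simp [hσ₁, Store.setReal_real]
    have b1 : ∀ i, σ₁.real 1 i = σ.real 1 i := fun i => by simp [hσ₁, Store.setReal_real]
    have b2 : ∀ i, σ₁.real 2 i = σ.real 2 i := fun i => by simp [hσ₁, Store.setReal_real]
    clear_value σ₁
    refine Runs.seq (runs_computeSizes hA hS a5 a6).frame fun σ₂ h₂ => ?_
    obtain ⟨⟨a7, a8⟩, hf₂⟩ := h₂
    have hf₂r : ∀ k, σ₂.real k = σ₁.real k := fun k =>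
      hf₂.real k (by simp [computeSizes, Program.WritesReal])
    have hf₂n : ∀ k, k < 7 → σ₂.nat (N + k) = σ₁.nat (N + k) := fun k hk =>
      hf₂.nat _ (by simp [computeSizes, Program.WritesNat]; omega)
    refine Runs.seq (runs_copyTables (M := M) hA hS a8 fun s a s' => by
      rw [hf₂r, b1, hr]).frame fun σ₃ h₃ => ?_
    obtain ⟨⟨c5, c12⟩, hf₃⟩ := h₃
    have hf₃n : ∀ k, k ≠ 11 → σ₃.nat (N + k) = σ₂.nat (N + k) := fun k hk =>
      hf₃.nat _ (by simpa [copyTables, Program.WritesNat])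
    have hf₃r : ∀ k, 7 ≤ k → k ≠ 12 → σ₃.real (N + k) = σ₂.real (N + k) := fun k hk hk' =>
      hf₃.real _ (by simp [copyTables, Program.WritesReal]; omega)
    have h₃5 : σ₃.nat (N + 5) 0 = S := by rw [hf₃n 5 (by omega), hf₂n 5 (by omega), a5]
    refine Runs.seq (runs_copyValues hS h₃5).frame fun σ₄ h₄ => ?_
    obtain ⟨c7, hf₄⟩ := h₄
    have hf₄n : ∀ k, k ≠ 11 → σ₄.nat (N + k) = σ₃.nat (N + k) := fun k hk =>
      hf₄.nat _ (by simpa [copyValues, Program.WritesNat])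
    have hf₄r : ∀ k, k ≠ 7 → σ₄.real (N + k) = σ₃.real (N + k) := fun k hk =>
      hf₄.real _ (by simpa [copyValues, Program.WritesReal])
    have d6 : σ₄.nat (N + 6) 0 = A := by
      rw [hf₄n 6 (by omega), hf₃n 6 (by omega), hf₂n 6 (by omega), a6]
    have d9 : σ₄.real (N + 9) 0 = M.lam := by
      rw [hf₄r 9 (by omega), hf₃r 9 (by omega) (by omega), hf₂r, b9]
    have d10 : σ₄.real (N + 10) 0 = M.kappa := by
      rw [hf₄r 10 (by omega), hf₃r 10 (by omega) (by omega), hf₂r, b10]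
    have d11 : σ₄.real (N + 11) 0 = ε := by
      rw [hf₄r 11 (by omega), hf₃r 11 (by omega) (by omega), hf₂r, b11]
    have d12 := (congrFun (hf₄r 12 (by omega)) 0).trans c12
    refine (runs_computeAccuracy d9 d10 d11 d12 d6).frame.mono le_rfl ?_
    rintro τ ⟨e12, hf⟩
    have hfn : ∀ k, τ.nat k = σ₄.nat k := fun k =>
      hf.nat k (by simp [computeAccuracy, Program.WritesNat])
    have hfr : ∀ k, k ≠ 12 → τ.real (N + k) = σ₄.real (N + k) := fun k hk =>
      hf.real _ (by simpa [computeAccuracy, Program.WritesReal])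
    refine ⟨?_, ?_, ?_, fun s a s' => ?_, fun s a s' => ?_, fun s => ?_, ?_, ?_, ?_, ?_⟩
    · rw [hfn, hf₄n 5 (by omega), h₃5]
    · rw [hfn, d6]
    · rw [hfn, hf₄n 7 (by omega), hf₃n 7 (by omega), a7]
    · rw [hfr 5 (by omega), hf₄r 5 (by omega), (c5 _ (rowIndex_lt s a s')).1, hf₂r, b0, hp]
    · rw [hfr 6 (by omega), hf₄r 6 (by omega), (c5 _ (rowIndex_lt s a s')).2, hf₂r, b1, hr]
    · rw [hfr 7 (by omega), c7 s s.2, hf₃.real 2 (by simp [copyTables, Program.WritesReal]), hf₂r,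
        b2, hv]
    · rw [hfr 9 (by omega), d9]
    · rw [hfr 10 (by omega), d10]
    · rw [hfr 11 (by omega), d11]
    · rw [e12]; rfl
  · have h1 : 1 ≤ S * (A * S) := Nat.mul_pos hS (Nat.mul_pos hA hS)
    have h3 : S ≤ S * (A * S) := Nat.le_mul_of_pos_right _ (Nat.mul_pos hA hS)
    simp only [RExp.cost, NExp.cost]; omega

lemma runs_bellmanProgram (hφ : IsDivergenceFunction φ) (hb : ∀ s a s', 0 ≤ M.payoff v s a s')
    (hv : ∀ s, v s ≤ M.Rbar) (hN : P.WritesBelow N) (hA : 0 < A) (hS : 0 < S) (hε : 0 < ε)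
    (hσ : M.LoadedIn v ε σ)
    (hP : ∀ s a β, (∃ i, M.payoff v s a i + ε / 2 ≤ β) →
      β < ∑ i, M.payoff v s a i * M.pbar s a i →
      LowerBounds F φ P K (M.projection v s a β) (M.projectionAccuracy ε))
    (hJ : M.Rbar ≤ ε * 2 ^ J) :
    Runs F (bellmanProgram P N) σ (1000 * (S * (A * (S + K)) * (J + 1)))
      (fun τ => ∀ s : Fin S, |τ.real 4 s - M.bellman φ v s| ≤ ε) := by
  refine Runs.mono_time (Runs.seq (runs_setup hA hS hσ) fun σ₁ h₁ => Runs.setNat_seq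
    (Runs.seq (Runs.forLoop (T := 300 * (A * (S + K)) * (J + 1)) (m := S) (Inv := fun k τ =>
      Holds N M v ε τ ∧ τ.nat (N + 13) 0 = k * (A * S) ∧
        ∀ s : Fin S, s < k → |τ.real (N + 8) s - M.bellman φ v s| ≤ ε)
      (by omega) ?_ ?_ ?_ ?_ ?_) fun ρ hρ =>
        (runs_copyOutput hS hρ.1.states).mono le_rfl fun τ hτ s => ?_)) ?_
  · simp [stateUpdate, initBounds, bisectionStep, sumProjections, callProjection,
      Program.WritesNat, hN.not_writesNat]
  · simp [stateUpdate, initBounds, bisectionStep, sumProjections, callProjection,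
      Program.WritesNat, hN.not_writesNat]
  · simpa [Store.setNat_nat] using h₁.states
  · refine ⟨?_, by simp [Store.setNat_nat, NExp.eval], by simp⟩
    refine h₁.of_frame (c := .seq (assignNat (N + 13) (.lit 0)) (assignNat (N + 9) (.lit 0)))
      (((Program.Frame.refl _ _).setNat (by simp [Program.WritesNat])).setNat
        (by simp [Program.WritesNat])) ?_ ?_
    · simp [Program.WritesNat]; omega
    · simp [Program.WritesReal]
  · rintro k hk τ ⟨h1, h2, h3⟩ hik -
    refine (runs_stateUpdate (s := ⟨k, hk⟩) hφ hb hv hN hA hε h1 h2 hik (hP _) hJ).frame.mono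
      le_rfl ?_
    rintro ρ ⟨⟨h4, h5, h6⟩, hf⟩
    have hρ : Holds N M v ε ρ := by
      refine h1.of_frame hf ?_ ?_
      · simp [stateUpdate, initBounds, bisectionStep, sumProjections, callProjection,
          Program.WritesNat, hN.not_writesNat]
        omega
      · simp [stateUpdate, initBounds, bisectionStep, sumProjections, callProjection,
          Program.WritesReal, hN.not_writesReal]
        omega
    refine ⟨hρ.of_frame (c := assignNat (N + 9) (.lit 0))
      ((Program.Frame.refl _ _).setNat (by simp [Program.WritesNat]))
      (by simp [Program.WritesNat]; omega) (by simp [Program.WritesReal]), ?_, fun s hs => ?_⟩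
    · simpa [Store.setNat_nat] using h6
    · rcases (Nat.lt_succ_iff.1 hs).lt_or_eq with hs | hs
      · rw [Store.setNat_real, h5 _ hs.ne]; exact h3 s hs
      · obtain rfl : s = ⟨k, hk⟩ := Fin.ext hs
        exact h4
  · rw [hτ s s.2]; exact hρ.2.2 s s.2
  · simp only [NExp.cost]
    have h1 : 1 ≤ S * (A * (S + K)) := Nat.mul_pos hS (Nat.mul_pos hA (by omega))
    have h2 : S * (A * S) ≤ S * (A * (S + K)) :=
      Nat.mul_le_mul_left _ (Nat.mul_le_mul_left A (by omega))
    have h3 : S ≤ S * (A * (S + K)) := Nat.le_mul_of_pos_right _ (Nat.mul_pos hA (by omega))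
    have h4 : S * (A * (S + K)) ≤ S * (A * (S + K)) * (J + 1) :=
      Nat.le_mul_of_pos_right _ (by omega)
    have h5 : S * (300 * (A * (S + K)) * (J + 1) + 11) =
        300 * (S * (A * (S + K)) * (J + 1)) + 11 * S := by
      ring
    omega

end RealRAM

/-! ### The time bound -/

/-- The number of halvings that bring `R` below `ε`. -/
lemma exists_halvings {R ε : ℝ} (hε : 0 < ε) :
    ∃ J : ℕ, R ≤ ε * 2 ^ J ∧ (J : ℝ) + 1 ≤ 4 * max 1 (Real.log (R / ε)) := by
  rcases le_or_gt R ε with hR | hR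
  · exact ⟨0, by simpa using hR, by have := le_max_left 1 (Real.log (R / ε)); push_cast; linarith⟩
  · have h2 : (0.6931471803 : ℝ) < Real.log 2 := Real.log_two_gt_d9
    have hq : 1 < R / ε := (one_lt_div hε).2 hR
    have hl : 0 < Real.log (R / ε) := Real.log_pos hq
    refine ⟨⌈Real.log (R / ε) / Real.log 2⌉₊, ?_, ?_⟩
    · have h3 := Nat.le_ceil (Real.log (R / ε) / Real.log 2)
      rw [div_le_iff₀ (by linarith), ← Real.log_pow, Real.log_le_log_iff (by linarith)
        (by positivity), div_le_iff₀ hε] at h3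
      linarith
    · have h3 := Nat.ceil_lt_add_one (a := Real.log (R / ε) / Real.log 2) (by positivity)
      have h4 : Real.log (R / ε) / Real.log 2 ≤ 2 * Real.log (R / ε) := by
        rw [div_le_iff₀ (by linarith)]; nlinarith
      have h5 := le_max_left 1 (Real.log (R / ε))
      have h6 := le_max_right 1 (Real.log (R / ε))
      linarith

theorem mainTheorem1
    (F : ℕ → ℝ → ℝ) (φ : ℝ≥0 → ℝ≥0∞) (hφ : IsDivergenceFunction φ) (P : RealRAM.Program) :
    ∃ Q : RealRAM.Program, ∀ C : ℝ, 0 < C → ∃ C' : ℝ, 0 < C' ∧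
      ∀ (𝒟 : Set ProjectionInstance) (h : ℝ → ℝ),
        SolvesProjections F φ P 𝒟 (fun δ => C * h δ) →
        ∀ (S A : ℕ), 0 < S → 0 < A → ∀ (M : RobustMDP S A) (v : Fin S → ℝ) (ε : ℝ), 0 < ε →
          (∀ s a s', 0 ≤ M.payoff v s a s') →
          (∀ s, v s ≤ M.Rbar) →
          (∀ (s : Fin S) (a : Fin A) (β : ℝ), (∃ s', M.payoff v s a s' + ε / 2 ≤ β) →
            β < ∑ s', M.payoff v s a s' * M.pbar s a s' → M.projection v s a β ∈ 𝒟) →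
          (S : ℝ) ≤ h (M.projectionAccuracy ε) →
          M.ComputesBellman F φ Q v ε
            (C' * (A * S * h (M.projectionAccuracy ε) * max 1 (Real.log (M.Rbar / ε)))) := by
  obtain ⟨N, hN⟩ := P.exists_writes_lt
  refine ⟨RealRAM.bellmanProgram P N, fun C hC => ⟨4000 * (1 + C), by positivity, ?_⟩⟩
  intro 𝒟 h hsolve S A hS hA M v ε hε hb hv h𝒟 hSh σ hσ
  set δ := M.projectionAccuracy ε with hδ
  have hδ0 : 0 < δ := M.projectionAccuracy_pos hA hε
  obtain ⟨J, hJ, hJ'⟩ := exists_halvings (R := M.Rbar) hε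
  have hh : 0 ≤ h δ := (Nat.cast_nonneg S).trans hSh
  have hP : ∀ s a β, (∃ i, M.payoff v s a i + ε / 2 ≤ β) →
      β < ∑ i, M.payoff v s a i * M.pbar s a i →
      RealRAM.LowerBounds F φ P ⌊C * h δ⌋₊ (M.projection v s a β) δ := by
    rintro s a β ⟨i, hi⟩ hβ σ' hσ'
    have hβ0 : 0 ≤ β := by linarith [hb s a i]
    have hadm : (M.projection v s a β).Admissible :=
      ⟨M.pbar_mem s a, hb s a, hβ0, ⟨i, by
        change M.payoff v s a i ≤ β; linarith⟩, hβ⟩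
    obtain ⟨τ, n, hex, hn, h1, h2, h3, h4⟩ := hsolve _ (h𝒟 s a β ⟨i, hi⟩ hβ) hadm δ hδ0 σ' hσ'
    exact ⟨τ, n, hex, Nat.le_floor hn, h1, h2, by linarith⟩
  obtain ⟨τ, n, hex, hn, hτ⟩ := RealRAM.runs_bellmanProgram hφ hb hv hN hA hS hε hσ hP hJ
  refine ⟨τ, n, hex, ?_, hτ⟩
  have hK : (⌊C * h δ⌋₊ : ℝ) ≤ C * h δ := Nat.floor_le (by positivity)
  calc (n : ℝ) ≤ 1000 * (S * (A * (S + ⌊C * h δ⌋₊)) * (J + 1)) := by exact_mod_cast hn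
    _ ≤ 1000 * (S * (A * (h δ + C * h δ)) * (4 * max 1 (Real.log (M.Rbar / ε)))) := by gcongr
    _ = _ := by ring
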